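/- **Theorem 2.** Let $\mu\colon[0,1]\to[0,1]$ be a concave, strictly increasing function with $\mu(0)=0$, and suppose that $\mu$ does not satisfy the Osgood condition, i.e. $\int_0^1\frac{ds}{\mu(s)}<+\infty$. Then for every integer $m\ge 1$ there exist - a function $l\colon[0,1]\to\mathbb R$ with $l\in\mathcal C^\mu([0,1],\mathbb R)$, i.e. $\sup_{t,s\in[0,1],\,0<|t-s|\le1}\frac{|l(t)-l(s)|}{\mu(|t-s|)}<+\infty$, and with $\frac12\le l(t)\le\frac32$ for all $t\in[0,1]$, - functions $b_1,b_2,c\in C^\infty_b([0,1]\times\mathbb R^2,\mathbb R)$, and - a function $u\in C^\infty_b([0,1]\times\mathbb R^2,\mathbb R)$ with $u(1,\cdot)\equiv0$ in $\mathbb R^2$ but $u\not\equiv0$ in $[0,1]\times\mathbb R^2$, such that $$\partial_t u+(-1)^m\bigl(\partial_{x_1}^{2m}u+l(t)\,\partial_{x_2}^{2m}u\bigr)+b_1(t,x)\,\partial_{x_1}u+b_2(t,x)\,\partial_{x_2}u+c(t,x)\,u=0\quad\text{in }[0,1]\times\mathbb R^2 .$$ Here $C^\infty_b([0,1]\times\mathbb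 R^2,\mathbb R)$ is the space of real functions that are smooth on the closed set $[0,1]\times\mathbb R^2$ (one-sided in $t$ at $t=0,1$) and bounded there together with all their derivatives. -/

import Mathlib

open Set MeasureTheory
open scoped ContDiff

/-- A function `w` on `[0,1]` satisfies the Osgood condition if `∫₀¹ 1/w(s) ds = +∞`
(integral with values in `[0,+∞]`, with the convention `1/0 = +∞`). -/
def OsgoodCondition (w : ℝ → ℝ) : Prop :=
  ∫⁻ s in Icc (0 : ℝ) 1, (ENNReal.ofReal (w s))⁻¹ = ⊤

/-- `f ∈ C^μ(I, B)`: the quotients `‖f t - f s‖ / μ |t - s|`, over all `t, s ∈ I` with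
`0 < |t - s| ≤ 1`, are bounded. -/
def IsModulusContinuousOn {B : Type*} [NormedAddCommGroup B] (μ : ℝ → ℝ) (I : Set ℝ)
    (f : ℝ → B) : Prop :=
  ∃ K : ℝ, ∀ t ∈ I, ∀ s ∈ I, 0 < |t - s| → |t - s| ≤ 1 → ‖f t - f s‖ / μ |t - s| ≤ K

/-- The closed slab `[0,1] × ℝ²`, with points `(t, x₁, x₂)`. -/
def slab : Set (ℝ × ℝ × ℝ) := Icc (0 : ℝ) 1 ×ˢ univ

/-- `f ∈ C_b^∞([0,1] × ℝ²)`: `f` is smooth on the closed slab (one-sided at `t = 0` and `t = 1`),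
and `f` and each of its derivatives are bounded there. -/
def IsSmoothBounded (f : ℝ × ℝ × ℝ → ℝ) : Prop :=
  ContDiffOn ℝ ∞ f slab ∧
    ∀ k : ℕ, ∃ K : ℝ, ∀ p ∈ slab, ‖iteratedFDerivWithin ℝ k f slab p‖ ≤ K

/-- The time derivative at `(t, x₁, x₂)`, one-sided at `t = 0` and at `t = 1`. -/
noncomputable def partialT (u : ℝ × ℝ × ℝ → ℝ) (t x₁ x₂ : ℝ) : ℝ :=
  derivWithin (fun s => u (s, x₁, x₂)) (Icc (0 : ℝ) 1) t

/-- The `k`-th partial derivative in `x₁` at `(t, x₁, x₂)`. -/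
noncomputable def partialX₁ (k : ℕ) (u : ℝ × ℝ × ℝ → ℝ) (t x₁ x₂ : ℝ) : ℝ :=
  iteratedDeriv k (fun y => u (t, y, x₂)) x₁

/-- The `k`-th partial derivative in `x₂` at `(t, x₁, x₂)`. -/
noncomputable def partialX₂ (k : ℕ) (u : ℝ × ℝ × ℝ → ℝ) (t x₁ x₂ : ℝ) : ℝ :=
  iteratedDeriv k (fun y => u (t, x₁, y)) x₂

/-! The solution is a cascade of Fourier modes whose frequencies `k n` tend to infinity as time
approaches 1. With `z = k ^ (2 * m)`, a mode `V(t) cos (k x₁)` with `V' = -z V` solves the principal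
equation exactly; a mode `cos (k x₂)` must decay at rate `l(t) z`. All other errors come from
switching modes on and off. If the switched mode has amplitude `E` relative to a dominating mode,
the error is absorbed by first and zeroth order terms of size about `E` (`mode_compensation`): the
dominating mode and its gradient have no common zero, and sine-cosine identities remove every
space-dependent denominator.

Step `n`, in a rescaled time from 0 to 8, passes from `cos (k n x₁)` to `cos (k (n+1) x₁)` through
`cos (k n x₂)`. First `l` dips below 1, so that the `x₂` mode decays more slowly and comes to
dominate; the old `x₁` mode is then removed and the new one inserted. Next `l` rises above 1, the
`x₂` mode sinks below the new one and is removed. Wherever a cutoff is active, the relative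
amplitude is at most `exp (-p n)`, where `p n = d n * r n` and `d n` is the increment of `z` (`le₁`
to `le₄`, `lower_order_identity`).

The price is an oscillation of `l` of size `d n / z n`, of order `1 / n`, on the time scale `r n`.
The modulus requires `1 / n` to be controlled by `μ (r n)`, while finite total time requires `∑ r n
< ∞`; failure of the Osgood condition supplies such lengths (`exists_step_lengths`). They can also
be kept above a multiple of `1 / (n+1)^2`; with quadratic frequencies `p n` and `q n` then grow at
least linearly. Each derivative costs only powers of `n`, so `exp (-p n)` and `exp (-q n)` make all
the series smooth across `t = 1`. The calculus `IsSymbol` records this. -/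

/-- `g n x ≤ C (n+1)^D w n x` for some constants `C > 0` and `D`. -/
def PolyLE {E : Type*} (g w : ℕ → E → ℝ) : Prop :=
  ∃ C : ℝ, ∃ D : ℕ, 0 < C ∧ ∀ n x, g n x ≤ C * ((n : ℝ) + 1) ^ D * w n x

/-! ### Bounds up to polynomial losses in the index -/

namespace PolyLE

variable {E : Type*} {g g' w w' : ℕ → E → ℝ}

theorem nonneg_right (h : PolyLE g w) (hg : ∀ n x, 0 ≤ g n x) (n : ℕ) (x : E) : 0 ≤ w n x := by
  obtain ⟨C, D, hC, h⟩ := h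
  have h1 := (hg n x).trans (h n x)
  have h2 : 0 < C * ((n : ℝ) + 1) ^ D := by positivity
  exact nonneg_of_mul_nonneg_right h1 h2

theorem mono (h : PolyLE g w) (hw : ∀ n x, w n x ≤ w' n x) : PolyLE g w' := by
  obtain ⟨C, D, hC, h⟩ := h
  exact ⟨C, D, hC, fun n x => (h n x).trans (by gcongr; exact hw n x)⟩

theorem mono_left (h : PolyLE g w) (hg : ∀ n x, g' n x ≤ g n x) : PolyLE g' w := by
  obtain ⟨C, D, hC, h⟩ := h
  exact ⟨C, D, hC, fun n x => (hg n x).trans (h n x)⟩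

theorem self (hw : ∀ n x, g n x ≤ w n x) : PolyLE g w :=
  ⟨1, 0, one_pos, fun n x => by simpa using hw n x⟩

theorem add (hw : ∀ n x, 0 ≤ w n x) (h : PolyLE g w) (h' : PolyLE g' w) :
    PolyLE (fun n x => g n x + g' n x) w := by
  obtain ⟨C, D, hC, h⟩ := h
  obtain ⟨C', D', hC', h'⟩ := h'
  refine ⟨C + C', D + D', by positivity, fun n x => ?_⟩
  have h1 : (1 : ℝ) ≤ (n : ℝ) + 1 := by simp
  have e1 : ((n : ℝ) + 1) ^ D ≤ ((n : ℝ) + 1) ^ (D + D') := pow_le_pow_right₀ h1 (by lia)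
  have e2 : ((n : ℝ) + 1) ^ D' ≤ ((n : ℝ) + 1) ^ (D + D') := pow_le_pow_right₀ h1 (by lia)
  calc g n x + g' n x ≤ C * ((n : ℝ) + 1) ^ D * w n x + C' * ((n : ℝ) + 1) ^ D' * w n x :=
        add_le_add (h n x) (h' n x)
    _ ≤ C * ((n : ℝ) + 1) ^ (D + D') * w n x + C' * ((n : ℝ) + 1) ^ (D + D') * w n x := by
        have := hw n x
        gcongr
    _ = _ := by ring

theorem mul (hg : ∀ n x, 0 ≤ g n x) (hg' : ∀ n x, 0 ≤ g' n x)
    (h : PolyLE g w) (h' : PolyLE g' w') :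
    PolyLE (fun n x => g n x * g' n x) (fun n x => w n x * w' n x) := by
  obtain ⟨C, D, hC, h⟩ := h
  obtain ⟨C', D', hC', h'⟩ := h'
  refine ⟨C * C', D + D', by positivity, fun n x => ?_⟩
  calc g n x * g' n x ≤ (C * ((n : ℝ) + 1) ^ D * w n x) * (C' * ((n : ℝ) + 1) ^ D' * w' n x) :=
        mul_le_mul (h n x) (h' n x) (hg' n x) ((hg n x).trans (h n x))
    _ = _ := by ring

theorem const_mul {c : ℝ} (hc : 0 ≤ c) (hw : ∀ n x, 0 ≤ w n x) (h : PolyLE g w) :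
    PolyLE (fun n x => c * g n x) w := by
  obtain ⟨C, D, hC, h⟩ := h
  refine ⟨(c + 1) * C, D, by positivity, fun n x => ?_⟩
  calc c * g n x ≤ c * (C * ((n : ℝ) + 1) ^ D * w n x) := by gcongr; exact h n x
    _ ≤ (c + 1) * (C * ((n : ℝ) + 1) ^ D * w n x) := by
        have := hw n x
        gcongr
        linarith
    _ = _ := by ring

theorem finset_sum {ι : Type*} (s : Finset ι) {g : ι → ℕ → E → ℝ} (hw : ∀ n x, 0 ≤ w n x)
    (h : ∀ i ∈ s, PolyLE (g i) w) : PolyLE (fun n x => ∑ i ∈ s, g i n x) w := by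
  classical
  induction s using Finset.induction_on with
  | empty => exact self (by simpa using hw)
  | insert i s hi ih =>
    simp only [Finset.sum_insert hi]
    exact add hw (h i (by simp)) (ih fun j hj => h j (by simp [hj]))

end PolyLE

/-! ### Symbol calculus and smooth sums -/

section Symbols

variable {E F : Type*} [NormedAddCommGroup E] [NormedSpace ℝ E]
  [NormedAddCommGroup F] [NormedSpace ℝ F] {f g : ℕ → E → ℝ} {w v : ℕ → E → ℝ} {K : ℕ}

/-- A sequence of smooth functions whose derivatives up to order `K` are bounded by the weight `w`
up to factors growing polynomially along the sequence. -/
def IsSymbolUpTo (K : ℕ) (w f : ℕ → E → ℝ) : Prop :=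
  (∀ n, ContDiff ℝ ∞ (f n)) ∧
    ∀ k ≤ K, PolyLE (fun n x => ‖iteratedFDeriv ℝ k (f n) x‖) w

/-- A sequence of smooth functions all of whose derivatives are bounded by the weight `w`
up to factors growing polynomially along the sequence. -/
def IsSymbol (w f : ℕ → E → ℝ) : Prop := ∀ K, IsSymbolUpTo K w f

namespace IsSymbolUpTo

theorem nonneg (hf : IsSymbolUpTo K w f) (n : ℕ) (x : E) : 0 ≤ w n x :=
  (hf.2 0 (Nat.zero_le _)).nonneg_right (fun _ _ => norm_nonneg _) n x

theorem mono (hf : IsSymbolUpTo K w f) (hw : ∀ n x, w n x ≤ v n x) : IsSymbolUpTo K v f :=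
  ⟨hf.1, fun k hk => (hf.2 k hk).mono hw⟩

theorem add (hf : IsSymbolUpTo K w f) (hg : IsSymbolUpTo K w g) :
    IsSymbolUpTo K w (fun n x => f n x + g n x) := by
  refine ⟨fun n => (hf.1 n).add (hg.1 n), fun k hk => ?_⟩
  refine ((hf.2 k hk).add hf.nonneg (hg.2 k hk)).mono_left fun n x => ?_
  change ‖iteratedFDeriv ℝ k (f n + g n) x‖ ≤ _
  rw [iteratedFDeriv_add (((hf.1 n).of_le (by exact_mod_cast le_top)))
    ((hg.1 n).of_le (by exact_mod_cast le_top))]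
  exact norm_add_le _ _

theorem mul (hf : IsSymbolUpTo K w f) (hg : IsSymbolUpTo K v g) :
    IsSymbolUpTo K (fun n x => w n x * v n x) (fun n x => f n x * g n x) := by
  refine ⟨fun n => (hf.1 n).mul (hg.1 n), fun k hk => ?_⟩
  have h0 : ∀ n x, 0 ≤ w n x * v n x := fun n x => mul_nonneg (hf.nonneg n x) (hg.nonneg n x)
  have key : PolyLE (fun n x => ∑ i ∈ Finset.range (k + 1), (k.choose i : ℝ) *
      (‖iteratedFDeriv ℝ i (f n) x‖ * ‖iteratedFDeriv ℝ (k - i) (g n) x‖))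
      (fun n x => w n x * v n x) := by
    refine PolyLE.finset_sum _ h0 fun i hi => ?_
    refine PolyLE.const_mul (by positivity) h0 ?_
    exact PolyLE.mul (fun _ _ => norm_nonneg _) (fun _ _ => norm_nonneg _)
      (hf.2 i (by have := Finset.mem_range.1 hi; lia)) (hg.2 (k - i) (by lia))
  refine key.mono_left fun n x => ?_
  refine (norm_iteratedFDeriv_mul_le (hf.1 n) (hg.1 n) x (by exact_mod_cast le_top)).trans
    (le_of_eq ?_)
  simp only [mul_assoc]

theorem const {c : ℕ → ℝ} (hc : PolyLE (fun n (_ : E) => |c n|) (fun _ _ => 1)) :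
    IsSymbolUpTo K (fun _ _ => 1) (fun n (_ : E) => c n) := by
  refine ⟨fun n => contDiff_const, fun k _ => ?_⟩
  rcases Nat.eq_zero_or_pos k with rfl | hk
  · exact hc.mono_left fun n x => by simp
  · refine PolyLE.self fun n x => ?_
    rw [iteratedFDeriv_const_of_ne hk.ne']
    simp

/-- This makes induction on the order available in one variable: for `exp`, `inv` and affine
substitution the derivative is a product of the same expression with known symbols. -/
theorem succ_iff {w f : ℕ → ℝ → ℝ} : IsSymbolUpTo (K + 1) w f ↔
    (∀ n, ContDiff ℝ ∞ (f n)) ∧ PolyLE (fun n x => |f n x|) w ∧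
      IsSymbolUpTo K w (fun n => deriv (f n)) := by
  have e : ∀ k n x, ‖iteratedFDeriv ℝ (k + 1) (f n) x‖ = ‖iteratedFDeriv ℝ k (deriv (f n)) x‖ := by
    intro k n x
    rw [norm_iteratedFDeriv_eq_norm_iteratedDeriv, norm_iteratedFDeriv_eq_norm_iteratedDeriv,
      iteratedDeriv_succ']
  constructor
  · rintro ⟨h1, h2⟩
    refine ⟨h1, ?_, fun n => ?_, fun k hk => ?_⟩
    · exact (h2 0 (Nat.zero_le _)).mono_left fun n x => by simp
    · exact ((contDiff_infty_iff_deriv).1 (h1 n)).2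
    · simpa only [e] using h2 (k + 1) (by lia)
  · rintro ⟨h1, h2, h3⟩
    refine ⟨h1, fun k hk => ?_⟩
    rcases k with _ | k
    · exact h2.mono_left fun n x => by simp
    · simpa only [e] using h3.2 k (by lia)

theorem zero_of {w f : ℕ → ℝ → ℝ} (h1 : ∀ n, ContDiff ℝ ∞ (f n))
    (h2 : PolyLE (fun n x => |f n x|) w) : IsSymbolUpTo 0 w f :=
  ⟨h1, fun k hk => by
    obtain rfl : k = 0 := by lia
    exact h2.mono_left fun n x => by simp⟩

end IsSymbolUpTo

namespace IsSymbol

theorem contDiff (hf : IsSymbol w f) (n : ℕ) : ContDiff ℝ ∞ (f n) := (hf 0).1 n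

theorem mono (hf : IsSymbol w f) (hw : ∀ n x, w n x ≤ v n x) : IsSymbol v f :=
  fun K => (hf K).mono hw

theorem add (hf : IsSymbol w f) (hg : IsSymbol w g) : IsSymbol w (fun n x => f n x + g n x) :=
  fun K => (hf K).add (hg K)

theorem mul (hf : IsSymbol w f) (hg : IsSymbol v g) :
    IsSymbol (fun n x => w n x * v n x) (fun n x => f n x * g n x) :=
  fun K => (hf K).mul (hg K)

theorem mul_one (hf : IsSymbol w f) (hg : IsSymbol (fun _ _ => 1) g) :
    IsSymbol w (fun n x => f n x * g n x) := by
  simpa using hf.mul hg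

theorem const {c : ℕ → ℝ} (hc : PolyLE (fun n (_ : E) => |c n|) (fun _ _ => 1)) :
    IsSymbol (fun _ _ => 1) (fun n (_ : E) => c n) := fun _ => IsSymbolUpTo.const hc

theorem const' (c : ℝ) : IsSymbol (fun _ _ => 1) (fun _ (_ : E) => c) :=
  const ⟨|c| + 1, 0, by positivity, fun n x => by simp⟩

theorem neg (hf : IsSymbol w f) : IsSymbol w (fun n x => -f n x) := by
  simpa using hf.mul_one (const' (-1))

theorem sub (hf : IsSymbol w f) (hg : IsSymbol w g) : IsSymbol w (fun n x => f n x - g n x) := by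
  simpa only [sub_eq_add_neg] using hf.add hg.neg

/-- All derivatives vanish off a closed set containing the support. A cutoff thus allows an
exponential factor to be estimated only where the cutoff lives. -/
theorem indicator (hf : IsSymbol w f) {S : ℕ → Set E} (hS : ∀ n, IsClosed (S n))
    (h : ∀ n x, x ∉ S n → f n x = 0) : IsSymbol (fun n => (S n).indicator (w n)) f := by
  refine fun K => ⟨hf.contDiff, fun k hk => ?_⟩
  obtain ⟨C, D, hC, hb⟩ := (hf K).2 k hk
  refine ⟨C, D, hC, fun n x => ?_⟩
  by_cases hx : x ∈ S n
  · simpa [hx] using hb n x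
  · have h1 : tsupport (f n) ⊆ S n := by
      refine closure_minimal (fun y hy => ?_) (hS n)
      by_contra hy'
      exact hy (h n y hy')
    have h2 : iteratedFDeriv ℝ k (f n) x = 0 := by
      by_contra h3
      exact hx (h1 (support_iteratedFDeriv_subset k h3))
    simp [hx, h2]

theorem comp_clm (hf : IsSymbol w f) (L : F →L[ℝ] E) :
    IsSymbol (fun n x => w n (L x)) (fun n x => f n (L x)) := by
  refine fun K => ⟨fun n => (hf.contDiff n).comp L.contDiff, fun k hk => ?_⟩
  obtain ⟨C, D, hC, hb⟩ := (hf K).2 k hk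
  refine ⟨C * (‖L‖ ^ k + 1), D, by positivity, fun n x => ?_⟩
  change ‖iteratedFDeriv ℝ k (f n ∘ L) x‖ ≤ _ * w n (L x)
  rw [L.iteratedFDeriv_comp_right (hf.contDiff n) x (by exact_mod_cast le_top)]
  refine (ContinuousMultilinearMap.norm_compContinuousLinearMap_le _ _).trans ?_
  rw [Finset.prod_const, Finset.card_univ, Fintype.card_fin]
  have h2 := hb n (L x)
  have h3 := (norm_nonneg _).trans h2
  calc _ ≤ (C * ((n : ℝ) + 1) ^ D * w n (L x)) * (‖L‖ ^ k + 1) :=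
        mul_le_mul h2 (by linarith) (by positivity) h3
    _ = _ := by ring

section Real

variable {f h w : ℕ → ℝ → ℝ}

theorem deriv (hf : IsSymbol w f) : IsSymbol w (fun n => deriv (f n)) :=
  fun K => (IsSymbolUpTo.succ_iff.1 (hf (K + 1))).2.2

theorem exp (hh : ∀ n, ContDiff ℝ ∞ (h n))
    (hd : IsSymbol (fun _ _ => 1) (fun n => _root_.deriv (h n))) :
    IsSymbol (fun n x => Real.exp (h n x)) (fun n x => Real.exp (h n x)) := by
  have hs : ∀ n, ContDiff ℝ ∞ (fun x => Real.exp (h n x)) := fun n => (hh n).exp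
  have h0 : PolyLE (fun n x => |Real.exp (h n x)|) (fun n x => Real.exp (h n x)) :=
    PolyLE.self fun n x => by rw [abs_of_pos (Real.exp_pos _)]
  intro K
  induction K with
  | zero => exact IsSymbolUpTo.zero_of hs h0
  | succ K ih =>
    refine IsSymbolUpTo.succ_iff.2 ⟨hs, h0, ?_⟩
    have e : (fun n => _root_.deriv (fun x => Real.exp (h n x))) =
        fun n x => Real.exp (h n x) * _root_.deriv (h n) x := by
      ext n x
      exact (((hh n).differentiable (by simp)) x).hasDerivAt.exp.deriv
    rw [e]
    simpa using ih.mul (hd K)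

theorem inv (hf : IsSymbol (fun _ _ => 1) f) (hpos : ∀ n x, 1 / 2 ≤ f n x) :
    IsSymbol (fun _ _ => 1) (fun n x => (f n x)⁻¹) := by
  have hne : ∀ n x, f n x ≠ 0 := fun n x h0 => by
    have := hpos n x
    norm_num [h0] at this
  have hs : ∀ n, ContDiff ℝ ∞ (fun x => (f n x)⁻¹) := fun n => (hf.contDiff n).inv (hne n)
  have h0 : PolyLE (fun n x => |(f n x)⁻¹|) (fun _ _ => 1) := by
    refine ⟨2, 0, by norm_num, fun n x => ?_⟩
    have h1 := hpos n x
    have h2 : (0:ℝ) < f n x := by linarith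
    have h3 : (f n x)⁻¹ ≤ 2 := inv_le_of_inv_le₀ (by norm_num) (by linarith)
    simpa [abs_of_pos h2] using h3
  intro K
  induction K with
  | zero => exact IsSymbolUpTo.zero_of hs h0
  | succ K ih =>
    refine IsSymbolUpTo.succ_iff.2 ⟨hs, h0, ?_⟩
    have e : (fun n => _root_.deriv (fun x => (f n x)⁻¹)) =
        fun n x => -_root_.deriv (f n) x * ((f n x)⁻¹ * (f n x)⁻¹) := by
      ext n x
      have := ((((hf.contDiff n).differentiable (by simp)) x).hasDerivAt.inv (hne n x)).deriv
      refine Eq.trans this ?_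
      have := hne n x
      field_simp
    rw [e]
    simpa using (hf.deriv.neg K).mul (ih.mul ih)

theorem comp_affine {g : ℝ → ℝ} (hg : IsSymbol (fun _ _ => 1) (fun _ => g)) {c b : ℕ → ℝ}
    (hc : PolyLE (fun n (_ : ℝ) => |c n|) (fun _ _ => 1)) :
    IsSymbol (fun _ _ => 1) (fun n t => g (c n * t + b n)) := by
  have hs : ∀ g : ℝ → ℝ, IsSymbol (fun _ _ => 1) (fun _ => g) → ∀ n : ℕ,
      ContDiff ℝ ∞ (fun t => g (c n * t + b n)) := fun g hg n =>
    (hg.contDiff 0).comp ((contDiff_const.mul contDiff_id).add contDiff_const)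
  have h0 : ∀ g : ℝ → ℝ, IsSymbol (fun _ _ => 1) (fun _ => g) →
      PolyLE (fun n t => |g (c n * t + b n)|) (fun _ _ => 1) := by
    intro g hg
    obtain ⟨C, D, hC, hb⟩ := (hg 0).2 0 le_rfl
    refine ⟨C, D, hC, fun n x => ?_⟩
    simpa using hb n (c n * x + b n)
  intro K
  induction K generalizing g with
  | zero => exact IsSymbolUpTo.zero_of (hs g hg) (h0 g hg)
  | succ K ih =>
    refine IsSymbolUpTo.succ_iff.2 ⟨hs g hg, h0 g hg, ?_⟩
    have e : (fun n => _root_.deriv (fun t => g (c n * t + b n))) =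
        fun n t => c n * _root_.deriv g (c n * t + b n) := by
      ext n t
      have h1 : HasDerivAt (fun t => c n * t + b n) (c n) t := by
        simpa using ((hasDerivAt_id t).const_mul (c n)).add_const (b n)
      have h2 := (((hg.contDiff 0).differentiable (by simp)) (c n * t + b n)).hasDerivAt
      rw [mul_comm]
      exact (h2.comp t h1).deriv
    rw [e]
    simpa using (IsSymbolUpTo.const hc).mul (ih hg.deriv)

end Real

end IsSymbol

theorem uniqueDiffOn_slab : UniqueDiffOn ℝ slab :=
  (uniqueDiffOn_Icc one_pos).prod uniqueDiffOn_univ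

/-- Each order of differentiation has its own polynomial loss, and `ρ` absorbs all of them, so the
series may be differentiated termwise. -/
theorem IsSymbol.contDiff_tsum_and_bounded {ρ : ℕ → ℝ} (hf : IsSymbol (fun n _ => ρ n) f)
    (hρ : ∀ D : ℕ, Summable fun n : ℕ => ((n : ℝ) + 1) ^ D * ρ n) :
    ContDiff ℝ ∞ (fun x => ∑' n, f n x) ∧
      ∀ k : ℕ, ∃ B : ℝ, ∀ x, ‖iteratedFDeriv ℝ k (fun x => ∑' n, f n x) x‖ ≤ B := by
  have hb : ∀ k, PolyLE (fun n x => ‖iteratedFDeriv ℝ k (f n) x‖) (fun n _ => ρ n) :=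
    fun k => (hf k).2 k le_rfl
  choose C D hC hb using hb
  have hv : ∀ k : ℕ, Summable fun n : ℕ => C k * (((n : ℝ) + 1) ^ D k * ρ n) :=
    fun k => (hρ (D k)).mul_left (C k)
  have hb' : ∀ (k n : ℕ) (x : E), ‖iteratedFDeriv ℝ k (f n) x‖ ≤
      C k * (((n : ℝ) + 1) ^ D k * ρ n) := fun k n x => by
    simpa [mul_assoc] using hb k n x
  refine ⟨contDiff_tsum (N := ⊤) hf.contDiff (fun k _ => hv k) (fun k n x _ => hb' k n x),
    fun k => ⟨∑' n : ℕ, C k * (((n : ℝ) + 1) ^ D k * ρ n), fun x => ?_⟩⟩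
  rw [iteratedFDeriv_tsum_apply (N := ⊤) hf.contDiff (fun k _ => hv k) (fun k n x _ => hb' k n x)
    (by exact_mod_cast le_top)]
  exact tsum_of_norm_bounded (hv k).hasSum fun n => hb' k n x

theorem IsSymbol.isSmoothBounded_tsum {f : ℕ → ℝ × ℝ × ℝ → ℝ} {ρ : ℕ → ℝ}
    (hf : IsSymbol (fun n _ => ρ n) f)
    (hρ : ∀ D : ℕ, Summable fun n : ℕ => ((n : ℝ) + 1) ^ D * ρ n) :
    IsSmoothBounded (fun x => ∑' n, f n x) := by
  obtain ⟨h1, h2⟩ := hf.contDiff_tsum_and_bounded hρ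
  refine ⟨h1.contDiffOn, fun k => ?_⟩
  obtain ⟨B, hB⟩ := h2 k
  refine ⟨B, fun p hp => ?_⟩
  rw [iteratedFDerivWithin_eq_iteratedFDeriv uniqueDiffOn_slab
    (h1.contDiffAt.of_le (by exact_mod_cast le_top)) hp]
  exact hB p

end Symbols

/-! ### Step lengths from the failure of the Osgood condition -/

theorem ConcaveOn.le_mul_of_zero {μ : ℝ → ℝ} (hconc : ConcaveOn ℝ (Icc 0 1) μ) (hzero : μ 0 = 0)
    {θ x : ℝ} (hθ : θ ∈ Icc (0 : ℝ) 1) (hx : x ∈ Icc (0 : ℝ) 1) : θ * μ x ≤ μ (θ * x) := by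
  have h := hconc.2 hx (left_mem_Icc.2 zero_le_one) hθ.1 (sub_nonneg.2 hθ.2) (by ring)
  simpa [hzero] using h

/-- For `y > 0` the sum counts positive integers below `1 / y`; for `y ≤ 0` the right side is
infinite. -/
theorem tsum_indicator_lt_inv_le (y : ℝ) :
    ∑' n : ℕ, (if y < 1 / ((n : ℝ) + 1) then (1 : ENNReal) else 0) ≤ (ENNReal.ofReal y)⁻¹ := by
  rcases le_or_gt y 0 with hy | hy
  · simp [ENNReal.ofReal_of_nonpos hy]
  · have h1 : ∀ n ∉ Finset.range ⌊1 / y⌋₊,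
        (if y < 1 / ((n : ℝ) + 1) then (1 : ENNReal) else 0) = 0 := by
      intro n hn
      rw [if_neg]
      intro h
      apply hn
      rw [Finset.mem_range, Nat.lt_iff_add_one_le]
      apply Nat.le_floor
      push_cast
      rw [lt_div_iff₀ (by positivity)] at h
      rw [le_div_iff₀ hy]
      linarith
    rw [tsum_eq_sum h1]
    calc _ ≤ ∑ n ∈ Finset.range ⌊1 / y⌋₊, (1 : ENNReal) :=
          Finset.sum_le_sum fun n _ => by split_ifs <;> simp
      _ = ENNReal.ofReal (⌊1 / y⌋₊ : ℝ) := by simp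
      _ ≤ ENNReal.ofReal (1 / y) := ENNReal.ofReal_le_ofReal (Nat.floor_le (by positivity))
      _ = _ := by rw [one_div, ENNReal.ofReal_inv_of_pos hy]

/-- A layer-cake argument: `ρ n` is the measure of the sublevel set `μ < 1 / (n+1)`, and these
measures sum to at most `∫ 1 / μ`. By monotonicity the sublevel set is an interval starting at 0, so
a point beyond its length lies outside it. -/
theorem exists_summable_levels {μ : ℝ → ℝ} (hmono : StrictMonoOn μ (Icc 0 1))
    (hosgood : ¬ OsgoodCondition μ) :
    ∃ ρ : ℕ → ℝ, Summable ρ ∧ (∀ n, 0 ≤ ρ n) ∧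
      ∀ n, ∀ y ∈ Icc (0 : ℝ) 1, ρ n < y → 1 / ((n : ℝ) + 1) ≤ μ y := by
  let S : ℕ → Set ℝ := fun n => {s | s ∈ Icc (0 : ℝ) 1 ∧ μ s < 1 / ((n : ℝ) + 1)}
  have hord : ∀ n, (S n).OrdConnected := by
    intro n
    refine ⟨fun x hx y hy z hz => ?_⟩
    have hz' : z ∈ Icc (0 : ℝ) 1 := ⟨hx.1.1.trans hz.1, hz.2.trans hy.1.2⟩
    exact ⟨hz', (hmono.monotoneOn hz' hy.1 hz.2).trans_lt hy.2⟩
  have hmeas : ∀ n, MeasurableSet (S n) := fun n => (hord n).measurableSet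
  have hsub : ∀ n, S n ⊆ Icc 0 1 := fun n s hs => hs.1
  have hfin : ∑' n, volume (S n) ≠ ⊤ := by
    refine ne_top_of_le_ne_top hosgood ?_
    calc ∑' n, volume (S n)
        = ∑' n, ∫⁻ s in Icc (0 : ℝ) 1, (S n).indicator 1 s := by
          congr 1
          ext n
          rw [lintegral_indicator_one (hmeas n), Measure.restrict_apply (hmeas n),
            inter_eq_left.2 (hsub n)]
      _ = ∫⁻ s in Icc (0 : ℝ) 1, ∑' n, (S n).indicator 1 s :=
          (lintegral_tsum fun n => (measurable_one.indicator (hmeas n)).aemeasurable).symm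
      _ ≤ ∫⁻ s in Icc (0 : ℝ) 1, (ENNReal.ofReal (μ s))⁻¹ := by
          refine setLIntegral_mono' measurableSet_Icc fun s hs => ?_
          refine le_trans (le_of_eq ?_) (tsum_indicator_lt_inv_le (μ s))
          congr 1
          ext n
          simp only [indicator, S, mem_ofPred_eq, hs, true_and, Pi.one_apply]
  refine ⟨fun n => (volume (S n)).toReal, ENNReal.summable_toReal hfin,
    fun n => ENNReal.toReal_nonneg, fun n y hy hlt => ?_⟩
  by_contra! hcon
  have h1 : Icc 0 y ⊆ S n := fun s hs => by
    have hs' : s ∈ Icc (0 : ℝ) 1 := ⟨hs.1, hs.2.trans hy.2⟩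
    exact ⟨hs', (hmono.monotoneOn hs' hy hs.2).trans_lt hcon⟩
  have h2 := measure_mono (μ := volume) h1
  have h3 : volume (S n) ≠ ⊤ := ENNReal.ne_top_of_tsum_ne_top hfin n
  have h4 := ENNReal.toReal_mono h3 h2
  rw [Real.volume_Icc, sub_zero, ENNReal.toReal_ofReal hy.1] at h4
  exact absurd hlt (not_lt.2 h4)

/-- A modulus of continuity violating the Osgood condition admits summable lengths `r n` along
which it decays no faster than `1 / n`. -/
theorem exists_step_lengths {μ : ℝ → ℝ} (hmaps : MapsTo μ (Icc 0 1) (Icc 0 1))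
    (hconc : ConcaveOn ℝ (Icc 0 1) μ) (hmono : StrictMonoOn μ (Icc 0 1)) (hzero : μ 0 = 0)
    (hosgood : ¬ OsgoodCondition μ) :
    ∃ (r : ℕ → ℝ) (c : ℝ), 0 < c ∧ r 0 = 1 ∧ HasSum (fun n => r (n + 1)) (1 / 8) ∧
      (∀ n : ℕ, c / ((n : ℝ) + 1) ^ 2 ≤ r n) ∧ (∀ n, r n ≤ 1) ∧
      ∀ n : ℕ, c / ((n : ℝ) + 1) ≤ μ (r n) := by
  obtain ⟨ρ, hsum, hnn, hρ⟩ := exists_summable_levels hmono hosgood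
  have h01 : (1 : ℝ) ∈ Icc (0 : ℝ) 1 := right_mem_Icc.2 zero_le_one
  have h00 : (0 : ℝ) ∈ Icc (0 : ℝ) 1 := left_mem_Icc.2 zero_le_one
  have hμ1 : 0 < μ 1 := by simpa [hzero] using hmono h00 h01 one_pos
  have hμ1' : μ 1 ≤ 1 := (hmaps h01).2
  -- The added term is summable, makes the inequality `ρ n < R n` strict, and keeps the inverse
  -- lengths polynomially bounded.
  let R : ℕ → ℝ := fun n => ρ n + 1 / ((n : ℝ) + 1) ^ 2
  have hRρ : ∀ n, ρ n < R n := fun n => by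
    have : 0 < 1 / ((n : ℝ) + 1) ^ 2 := by positivity
    simp only [R]; linarith
  have hR : ∀ n : ℕ, 1 / ((n : ℝ) + 1) ^ 2 ≤ R n := fun n => by
    have := hnn n
    simp only [R]; linarith
  have hRpos : ∀ n, 0 < R n := fun n => lt_of_lt_of_le (by positivity) (hR n)
  have hRsum : Summable R := by
    refine hsum.add ?_
    have := (summable_nat_add_iff 1).2 (Real.summable_one_div_nat_pow.2 (le_refl 2))
    simpa using this
  set T := ∑' n, R n with hT
  have hle : ∀ n, R n ≤ T := fun n => hRsum.le_tsum n fun j _ => (hRpos j).le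
  have hT1 : 1 ≤ T := by
    refine le_trans ?_ (hle 0)
    simpa using hR 0
  have hT0 : 0 < T := by linarith
  -- This normalises the sum to `1 / 8`: steps of duration `8 * r n` then fill the unit time
  -- interval. By concavity, scaling by `κ` costs only a factor `κ` in `μ`.
  let κ : ℝ := 1 / (8 * T)
  have hκ0 : 0 < κ := by positivity
  have hκ1 : κ ≤ 1 := by
    simp only [κ]
    rw [div_le_one (by positivity)]
    linarith
  have hκR : ∀ n, κ * R n ≤ 1 / 8 := fun n => by
    have := hle n
    simp only [κ]
    rw [div_mul_eq_mul_div, div_le_div_iff₀ (by positivity) (by norm_num)]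
    linarith
  have hy : ∀ n : ℕ, μ 1 / ((n : ℝ) + 1) ≤ μ (min (R n) 1) := by
    intro n
    rcases le_total (R n) 1 with h | h
    · rw [min_eq_left h]
      refine le_trans ?_ (hρ n _ ⟨(hRpos n).le, h⟩ (hRρ n))
      gcongr
    · rw [min_eq_right h]
      exact div_le_self hμ1.le (by simp)
  have hμr : ∀ n : ℕ, κ * (μ 1 / ((n : ℝ) + 1)) ≤ μ (κ * R n) := by
    intro n
    have hm : min (R n) 1 ∈ Icc (0 : ℝ) 1 := ⟨le_min (hRpos n).le zero_le_one, min_le_right _ _⟩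
    calc κ * (μ 1 / ((n : ℝ) + 1)) ≤ κ * μ (min (R n) 1) := by gcongr; exact hy n
      _ ≤ μ (κ * min (R n) 1) := hconc.le_mul_of_zero hzero ⟨hκ0.le, hκ1⟩ hm
      _ ≤ μ (κ * R n) := by
        refine hmono.monotoneOn ⟨mul_nonneg hκ0.le hm.1, mul_le_one₀ hκ1 hm.1 hm.2⟩
          ⟨by have := hRpos n; positivity, (hκR n).trans (by norm_num)⟩ ?_
        gcongr
        exact min_le_left _ _
  refine ⟨fun n => Nat.casesOn n 1 fun n => κ * R n, κ * μ 1, by positivity, rfl, ?_, ?_, ?_, ?_⟩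
  · have := hRsum.hasSum.mul_left κ
    have e : κ * T = 1 / 8 := by
      simp only [κ]
      field_simp
    rwa [← hT, e] at this
  · rintro (_ | n)
    · simpa using mul_le_one₀ hκ1 hμ1.le hμ1'
    · calc κ * μ 1 / (((n + 1 : ℕ) : ℝ) + 1) ^ 2 ≤ κ * 1 / ((n : ℝ) + 1) ^ 2 := by
            push_cast
            gcongr
            linarith
        _ = κ * (1 / ((n : ℝ) + 1) ^ 2) := by ring
        _ ≤ κ * R n := by gcongr; exact hR n
  · rintro (_ | n)
    · simp
    · exact (hκR n).trans (by norm_num)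
  · rintro (_ | n)
    · simpa using mul_le_of_le_one_left hμ1.le hκ1
    · calc κ * μ 1 / (((n + 1 : ℕ) : ℝ) + 1) ≤ κ * μ 1 / ((n : ℝ) + 1) := by
            push_cast
            gcongr
            linarith
        _ = κ * (μ 1 / ((n : ℝ) + 1)) := by ring
        _ ≤ μ (κ * R n) := hμr n

theorem PolyLE.shift {E : Type*} {g w : ℕ → E → ℝ} (hg : ∀ n x, 0 ≤ g n x) (h : PolyLE g w) :
    PolyLE (fun n => g (n + 1)) (fun n => w (n + 1)) := by
  have hw := h.nonneg_right hg
  obtain ⟨C, D, hC, h⟩ := h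
  refine ⟨C * 2 ^ D, D, by positivity, fun n x => (h (n + 1) x).trans ?_⟩
  have := hw (n + 1) x
  rw [mul_assoc C (2 ^ D), ← mul_pow]
  push_cast
  gcongr
  linarith [(Nat.cast_nonneg n : (0 : ℝ) ≤ n)]

theorem IsSymbol.shift {E : Type*} [NormedAddCommGroup E] [NormedSpace ℝ E] {w f : ℕ → E → ℝ}
    (hf : IsSymbol w f) : IsSymbol (fun n => w (n + 1)) (fun n => f (n + 1)) :=
  fun K => ⟨fun n => hf.contDiff (n + 1), fun k hk =>
    ((hf K).2 k hk).shift fun _ _ => norm_nonneg _⟩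

theorem indicator_one_mul_le {E : Type*} {s : Set E} {x : E} {y B : ℝ} (hB : 0 ≤ B)
    (h : x ∈ s → y ≤ B) : s.indicator (fun _ => (1 : ℝ)) x * y ≤ B := by
  by_cases hx : x ∈ s
  · simpa [hx] using h hx
  · simpa [hx] using hB

/-! ### Bounded symbols: sine, cosine and the smooth transition -/

theorem isSymbol_one_of_bounded {g : ℝ → ℝ} (hg : ContDiff ℝ ∞ g)
    (hb : ∀ k, ∃ B : ℝ, ∀ x, |iteratedDeriv k g x| ≤ B) :
    IsSymbol (fun _ _ => 1) (fun _ : ℕ => g) := by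
  refine fun K => ⟨fun _ => hg, fun k _ => ?_⟩
  obtain ⟨B, hB⟩ := hb k
  refine ⟨|B| + 1, 0, by positivity, fun n x => ?_⟩
  have h1 : ‖iteratedFDeriv ℝ k g x‖ ≤ |B| + 1 := by
    rw [norm_iteratedFDeriv_eq_norm_iteratedDeriv, Real.norm_eq_abs]
    linarith [hB x, le_abs_self B]
  simpa using h1

theorem isSymbol_cos : IsSymbol (fun _ _ => 1) (fun _ : ℕ => Real.cos) :=
  isSymbol_one_of_bounded Real.contDiff_cos fun k => ⟨1, Real.abs_iteratedDeriv_cos_le_one k⟩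

theorem isSymbol_sin : IsSymbol (fun _ _ => 1) (fun _ : ℕ => Real.sin) :=
  isSymbol_one_of_bounded Real.contDiff_sin fun k => ⟨1, Real.abs_iteratedDeriv_sin_le_one k⟩

namespace Real.smoothTransition

theorem deriv_eq_zero_of_nonpos {x : ℝ} (hx : x ≤ 0) : deriv smoothTransition x = 0 :=
  IsLocalMin.deriv_eq_zero <| Filter.Eventually.of_forall fun y => by
    rw [zero_of_nonpos hx]
    exact nonneg y

theorem deriv_eq_zero_of_one_le {x : ℝ} (hx : 1 ≤ x) : deriv smoothTransition x = 0 :=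
  IsLocalMax.deriv_eq_zero <| Filter.Eventually.of_forall fun y => by
    rw [one_of_one_le hx]
    exact le_one y

theorem bounded_iteratedDeriv (k : ℕ) : ∃ B : ℝ, ∀ x, |iteratedDeriv k smoothTransition x| ≤ B := by
  rcases k with _ | k
  · refine ⟨1, fun x => ?_⟩
    rw [iteratedDeriv_zero, abs_of_nonneg (nonneg x)]
    exact le_one x
  · have hc : HasCompactSupport (deriv smoothTransition) := by
      refine HasCompactSupport.intro (isCompact_Icc (a := (0 : ℝ)) (b := 1)) fun x hx => ?_
      rcases le_or_gt x 0 with h | h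
      · exact deriv_eq_zero_of_nonpos h
      · refine deriv_eq_zero_of_one_le ?_
        by_contra! h1
        exact hx ⟨h.le, h1.le⟩
    have hs : ContDiff ℝ ∞ (deriv smoothTransition) :=
      ((contDiff_infty_iff_deriv).1 (Real.smoothTransition.contDiff (n := ⊤))).2
    have hcont : Continuous (iteratedFDeriv ℝ k (deriv smoothTransition)) :=
      hs.continuous_iteratedFDeriv (by exact_mod_cast le_top)
    obtain ⟨B, hB⟩ := (hc.iteratedFDeriv k).exists_bound_of_continuous hcont
    refine ⟨B, fun x => ?_⟩
    rw [iteratedDeriv_succ', ← Real.norm_eq_abs, ← norm_iteratedFDeriv_eq_norm_iteratedDeriv]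
    exact hB x

theorem isSymbol : IsSymbol (fun _ _ => 1) (fun _ : ℕ => smoothTransition) :=
  isSymbol_one_of_bounded (Real.smoothTransition.contDiff (n := ⊤)) bounded_iteratedDeriv

end Real.smoothTransition

/-! ### The cascade: amplitudes, cutoffs and their estimates -/

/-- Step lengths `r` and frequencies `k` of a cascade of Fourier modes, for an operator of order
`2 * m`. -/
structure Cascade where
  m : ℕ
  r : ℕ → ℝ
  k : ℕ → ℝ

namespace Cascade

variable (S : Cascade)

/-- The decay rate of the `n`-th mode. -/
noncomputable def z (n : ℕ) : ℝ := S.k n ^ (2 * S.m)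

noncomputable def d (n : ℕ) : ℝ := S.z (n + 1) - S.z n

noncomputable def p (n : ℕ) : ℝ := S.d n * S.r n

/-- The total decay accumulated before the `n`-th mode starts. -/
noncomputable def q : ℕ → ℝ
  | 0 => 0
  | n + 1 => q n + 8 * S.z (n + 1) * S.r n

/-- The starting time of the `n`-th step, which has duration `8 * r n`; the first step starts at
time `0`. -/
noncomputable def a (n : ℕ) : ℝ := -8 + 8 * ∑ j ∈ Finset.range n, S.r j

/-- The rescaled time in the `n`-th step, running from `0` to `8`. -/
noncomputable def s (n : ℕ) (t : ℝ) : ℝ := (t - S.a n) / S.r n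

/-- The growth conditions under which the cascade produces smooth solutions. -/
structure Admissible : Prop where
  one_le_m : 1 ≤ S.m
  r_pos : ∀ n, 0 < S.r n
  r_zero : S.r 0 = 1
  hasSum_r : HasSum (fun n => S.r (n + 1)) (1 / 8)
  inv_r : PolyLE (fun n (_ : ℝ) => |(S.r n)⁻¹|) (fun _ _ => 1)
  one_le_k : ∀ n, 1 ≤ S.k n
  k_mono : Monotone S.k
  k_poly : PolyLE (fun n (_ : ℝ) => |S.k n|) (fun _ _ => 1)
  d_le : ∀ n, S.d n ≤ 2 * S.z n
  one_le_p : ∀ n, 1 ≤ S.p n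
  summable_p : ∀ D : ℕ, Summable fun n : ℕ => ((n : ℝ) + 1) ^ D * Real.exp (-S.p n)
  summable_q : ∀ D : ℕ, Summable fun n : ℕ => ((n : ℝ) + 1) ^ D * Real.exp (-S.q n)

/-- A smooth cutoff in time, adapted to the `n`-th step. -/
noncomputable def cut (e b : ℝ) (n : ℕ) (t : ℝ) : ℝ := Real.smoothTransition (e * S.s n t + b)

/-- The amplitude of the weaker mode relative to the dominating one. -/
noncomputable def ratio (e b : ℝ) (A B : ℕ → ℝ) (n : ℕ) (t : ℝ) : ℝ :=
  S.cut e b n t * Real.exp (A n + B n * (t - S.a n))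

/-- The size of the lower order coefficients that compensate the cutoff of the weaker mode. -/
noncomputable def gain (e b : ℝ) (A B : ℕ → ℝ) (n : ℕ) (t : ℝ) : ℝ :=
  deriv (S.cut e b n) t * Real.exp (A n + B n * (t - S.a n)) * (1 - S.ratio e b A B n t ^ 2)⁻¹

/-- The exponential decay of the modes in `x₁`. -/
noncomputable def v (n : ℕ) (t : ℝ) : ℝ := Real.exp (-S.q n - S.z n * (t - S.a n))

/-- The modulation of the decay of the modes in `x₂`. -/
noncomputable def J (n : ℕ) (t : ℝ) : ℝ := -8 + 9 * S.cut 1 (-2) n t - 9 * S.cut 1 (-5) n t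

/-- Logarithm of the uncut `x₂` amplitude. `J` is -8 up to rescaled time 2, rises to 1 on `[2, 3]`,
and returns to -8 on `[5, 6]`. -/
noncomputable def phase (n : ℕ) (t : ℝ) : ℝ :=
  -S.q n - S.z n * (t - S.a n) + S.p n * S.J n t

/-- Amplitude of the `x₁` mode of index `n + 1`, which enters during step `n` (rescaled time 4 to 5)
and leaves during step `n + 1` (3 to 4). -/
noncomputable def α (n : ℕ) (t : ℝ) : ℝ :=
  S.cut 1 (-4) n t * S.cut (-1) 4 (n + 1) t * S.v (n + 1) t

/-- Amplitude of the `x₂` mode, which enters on rescaled times 1 to 2 and leaves on 6 to 7. -/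
noncomputable def β (n : ℕ) (t : ℝ) : ℝ :=
  S.cut 1 (-1) n t * S.cut (-1) 7 n t * Real.exp (S.phase n t)

variable {S}

theorem a_succ (n : ℕ) : S.a (n + 1) = S.a n + 8 * S.r n := by
  simp only [a, Finset.sum_range_succ]; ring

theorem d_mul_r (n : ℕ) : S.d n * S.r n = S.p n := rfl

namespace Admissible

variable (hS : S.Admissible)
include hS

theorem z_pos (n : ℕ) : 0 < S.z n := pow_pos (by linarith [hS.one_le_k n]) _

theorem d_nonneg (n : ℕ) : 0 ≤ S.d n := by
  have := hS.one_le_k n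
  have h := hS.k_mono (Nat.le_succ n)
  exact sub_nonneg.2 (pow_le_pow_left₀ (by linarith) h _)

theorem r_mul_s (n : ℕ) (t : ℝ) : S.r n * S.s n t = t - S.a n :=
  mul_div_cancel₀ _ (hS.r_pos n).ne'

omit hS in
theorem continuous_s (n : ℕ) : Continuous (S.s n) := by
  unfold s; fun_prop

theorem isSymbol_cut (e b : ℝ) : IsSymbol (fun _ _ => 1) (S.cut e b) := by
  have h := Real.smoothTransition.isSymbol.comp_affine (c := fun n => e * (S.r n)⁻¹)
    (b := fun n => -e * (S.r n)⁻¹ * S.a n + b) ?_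
  · convert h using 3 with n t
    simp only [cut, s]
    congr 1
    ring
  · simp only [abs_mul]
    exact hS.inv_r.const_mul (abs_nonneg e) fun _ _ => zero_le_one

theorem isSymbol_cut_indicator (e b : ℝ) :
    IsSymbol (fun n => {t | 0 ≤ e * S.s n t + b}.indicator fun _ => 1) (S.cut e b) := by
  refine (hS.isSymbol_cut e b).indicator (fun n => ?_) fun n t ht => ?_
  · have := continuous_s (S := S) n
    exact isClosed_le continuous_const (by fun_prop)
  · have ht' : ¬ 0 ≤ e * S.s n t + b := ht
    exact Real.smoothTransition.zero_of_nonpos (by linarith)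

omit hS in
theorem isSymbol_exp_affine {A B : ℕ → ℝ}
    (hB : PolyLE (fun n (_ : ℝ) => |B n|) (fun _ _ => 1)) :
    IsSymbol (fun n t => Real.exp (A n + B n * (t - S.a n)))
      (fun n t => Real.exp (A n + B n * (t - S.a n))) := by
  refine IsSymbol.exp (h := fun n t => A n + B n * (t - S.a n)) (fun n => by fun_prop) ?_
  have e : (fun n => deriv fun t => A n + B n * (t - S.a n)) = fun n (_ : ℝ) => B n := by
    ext n t
    simp
  rw [e]
  exact IsSymbol.const hB

omit hS in
theorem mul_exp_symbol {e b : ℝ} {A B : ℕ → ℝ}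
    (hB : PolyLE (fun n (_ : ℝ) => |B n|) (fun _ _ => 1))
    (hle : ∀ n t, 0 ≤ e * S.s n t + b → A n + B n * (t - S.a n) ≤ -S.p n) {f : ℕ → ℝ → ℝ}
    (hf : IsSymbol (fun n => {t | 0 ≤ e * S.s n t + b}.indicator fun _ => 1) f) :
    IsSymbol (fun n _ => Real.exp (-S.p n))
      (fun n t => f n t * Real.exp (A n + B n * (t - S.a n))) := by
  exact (hf.mul (isSymbol_exp_affine hB)).mono fun n t =>
    indicator_one_mul_le (Real.exp_nonneg _) fun ht => Real.exp_le_exp.2 (hle n t ht)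

section Gain

variable {e b : ℝ} {A B : ℕ → ℝ} (hB : PolyLE (fun n (_ : ℝ) => |B n|) (fun _ _ => 1))
  (hle : ∀ n t, 0 ≤ e * S.s n t + b → A n + B n * (t - S.a n) ≤ -S.p n)
include hB hle

theorem isSymbol_ratio : IsSymbol (fun n _ => Real.exp (-S.p n)) (S.ratio e b A B) :=
  mul_exp_symbol hB hle (hS.isSymbol_cut_indicator e b)

omit hB in
-- Since `p n ≥ 1`, also `exp (-p n) ≤ 1 / 2`; this keeps the denominator in `gain` away from zero.
theorem abs_ratio_le (n : ℕ) (t : ℝ) : |S.ratio e b A B n t| ≤ 1 / 2 := by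
  have h1 : Real.exp (-S.p n) ≤ 1 / 2 := by
    have := hS.one_le_p n
    have h2 := Real.add_one_le_exp (S.p n)
    rw [Real.exp_neg, one_div]
    exact inv_anti₀ (by norm_num) (by linarith)
  rw [ratio, abs_mul, abs_of_pos (Real.exp_pos _)]
  by_cases ht : 0 ≤ e * S.s n t + b
  · have h2 := Real.exp_le_exp.2 (hle n t ht)
    have h3 : |S.cut e b n t| ≤ 1 := by
      rw [cut, abs_of_nonneg (Real.smoothTransition.nonneg _)]
      exact Real.smoothTransition.le_one _
    calc _ ≤ 1 * Real.exp (-S.p n) := by gcongr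
      _ ≤ _ := by linarith
  · rw [cut, Real.smoothTransition.zero_of_nonpos (by linarith)]
    norm_num

omit hB in
theorem half_le_one_sub_ratio_sq (n : ℕ) (t : ℝ) : 1 / 2 ≤ 1 - S.ratio e b A B n t ^ 2 := by
  have h := hS.abs_ratio_le hle n t
  have : S.ratio e b A B n t ^ 2 ≤ (1 / 2) ^ 2 := by
    rw [← sq_abs]
    gcongr
  linarith

theorem isSymbol_gain : IsSymbol (fun n _ => Real.exp (-S.p n)) (S.gain e b A B) := by
  have hr := (hS.isSymbol_ratio hB hle).mono (v := fun _ _ => 1) fun n t => by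
    rw [Real.exp_le_one_iff]
    linarith [hS.one_le_p n]
  have h1 : IsSymbol (fun _ _ => 1) (fun n t => 1 - S.ratio e b A B n t ^ 2) := by
    simpa only [sq] using (IsSymbol.const' (E := ℝ) 1).sub (hr.mul_one hr)
  exact (mul_exp_symbol hB hle (hS.isSymbol_cut_indicator e b).deriv).mul_one
    (h1.inv (hS.half_le_one_sub_ratio_sq hle))

end Gain

theorem isSymbol_J : IsSymbol (fun _ _ => 1) S.J := by
  have h9 := IsSymbol.const' (E := ℝ) 9
  exact ((IsSymbol.const' (-8)).add (h9.mul_one (hS.isSymbol_cut 1 (-2)))).sub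
    (h9.mul_one (hS.isSymbol_cut 1 (-5)))

theorem z_poly : PolyLE (fun n (_ : ℝ) => |S.z n|) (fun _ _ => 1) := by
  have h : ∀ j : ℕ, PolyLE (fun n (_ : ℝ) => |S.k n| ^ j) (fun _ _ => 1) := by
    intro j
    induction j with
    | zero => exact PolyLE.self (by simp)
    | succ j ih =>
      simpa [pow_succ] using ih.mul (fun _ _ => by positivity) (fun _ _ => abs_nonneg _) hS.k_poly
  simpa only [z, abs_pow] using h (2 * S.m)

theorem d_poly : PolyLE (fun n (_ : ℝ) => |S.d n|) (fun _ _ => 1) :=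
  (PolyLE.add (fun _ _ => zero_le_one) (hS.z_poly.shift fun _ _ => abs_nonneg _)
    hS.z_poly).mono_left fun _ _ => abs_sub _ _

theorem r_le_one (n : ℕ) : S.r n ≤ 1 := by
  rcases n with _ | n
  · exact hS.r_zero.le
  · have := le_hasSum hS.hasSum_r n fun j _ => (hS.r_pos _).le
    linarith

theorem p_poly : PolyLE (fun n (_ : ℝ) => |S.p n|) (fun _ _ => 1) :=
  hS.d_poly.mono_left fun _ _ => by
    rw [p, abs_mul, abs_of_pos (hS.r_pos _)]
    exact mul_le_of_le_one_right (abs_nonneg _) (hS.r_le_one _)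

theorem hasDerivAt_phase (n : ℕ) (t : ℝ) :
    HasDerivAt (S.phase n) (-S.z n + S.p n * deriv (S.J n) t) t := by
  have h1 : HasDerivAt (fun t => -S.q n - S.z n * (t - S.a n)) (-S.z n) t := by
    have := (((hasDerivAt_id t).sub_const (S.a n)).const_mul (S.z n)).const_sub (-S.q n)
    simpa using this
  have h2 := ((hS.isSymbol_J.contDiff n).differentiable (by simp) t).hasDerivAt.const_mul (S.p n)
  exact h1.add h2

theorem isSymbol_exp_phase : IsSymbol (fun n t => Real.exp (S.phase n t))
    (fun n t => Real.exp (S.phase n t)) := by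
  refine IsSymbol.exp (h := S.phase) (fun n => ?_) ?_
  · have := hS.isSymbol_J.contDiff n
    unfold phase
    fun_prop
  · have e : (fun n => deriv (S.phase n)) = fun n t => -S.z n + S.p n * deriv (S.J n) t := by
      ext n t
      exact (hS.hasDerivAt_phase n t).deriv
    rw [e]
    exact (IsSymbol.const hS.z_poly).neg.add ((IsSymbol.const hS.p_poly).mul_one hS.isSymbol_J.deriv)

omit hS in
theorem J_le_one (n : ℕ) (t : ℝ) : S.J n t ≤ 1 := by
  have h1 : S.cut 1 (-2) n t ≤ 1 := Real.smoothTransition.le_one _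
  have h2 : 0 ≤ S.cut 1 (-5) n t := Real.smoothTransition.nonneg _
  unfold J; linarith

/-- The modulation contributes at most `p n`, and nothing positive before rescaled time 2. By then
the plain decay amounts to `2 * z n * r n`, which dominates `p n` because `d n ≤ 2 * z n`. -/
theorem phase_le {n : ℕ} {t : ℝ} (ht : 0 ≤ S.s n t) : S.phase n t ≤ -S.q n := by
  have hz := hS.z_pos n
  have hr := hS.r_pos n
  have hp := hS.one_le_p n
  rw [phase, ← hS.r_mul_s]
  rcases le_total (S.s n t) 2 with h | h
  · have h1 : S.cut 1 (-2) n t = 0 := Real.smoothTransition.zero_of_nonpos (by linarith)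
    have h2 : 0 ≤ S.cut 1 (-5) n t := Real.smoothTransition.nonneg _
    have h3 : S.J n t ≤ 0 := by unfold J; linarith
    have h4 : S.p n * S.J n t ≤ 0 := mul_nonpos_of_nonneg_of_nonpos (by linarith) h3
    have h5 : 0 ≤ S.z n * (S.r n * S.s n t) := by positivity
    linarith
  · have h1 : S.p n * S.J n t ≤ S.p n :=
      mul_le_of_le_one_right (by linarith) (J_le_one n t)
    have h2 : S.p n ≤ 2 * S.z n * S.r n := mul_le_mul_of_nonneg_right (hS.d_le n) hr.le
    have h3 : S.z n * (S.r n * 2) ≤ S.z n * (S.r n * S.s n t) := by gcongr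
    linarith

/-- The mode exists only from half of step `n` on. Extended back that far, `v (n + 1)` gains at most
`4 * z (n + 1) * r n` in the exponent, half of what `q (n + 1)` adds to `q n`. -/
theorem isSymbol_α : IsSymbol (fun n _ => Real.exp (-S.q n)) S.α := by
  have h1 := (hS.isSymbol_cut_indicator 1 (-4)).mul_one (hS.isSymbol_cut (-1) 4).shift
  have hv : IsSymbol S.v S.v := by
    have := isSymbol_exp_affine (S := S) (A := fun n => -S.q n) (B := fun n => -S.z n)
      (by simpa using hS.z_poly)
    simp only [neg_mul, ← sub_eq_add_neg] at this
    exact this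
  refine (h1.mul hv.shift).mono fun n t =>
    indicator_one_mul_le (Real.exp_nonneg _) fun ht => Real.exp_le_exp.2 ?_
  have ht' : 0 ≤ 1 * S.s n t + -4 := ht
  have h2 : 0 < S.z (n + 1) := hS.z_pos _
  have h3 : S.r n * 4 ≤ S.r n * S.s n t := by
    have := hS.r_pos n
    gcongr
    linarith
  rw [hS.r_mul_s] at h3
  have h4 : S.z (n + 1) * (S.r n * 4 + S.a n - S.a (n + 1)) ≤ S.z (n + 1) * (t - S.a (n + 1)) := by
    gcongr
    linarith
  rw [a_succ] at h4 ⊢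
  have h5 : 0 ≤ S.z (n + 1) * S.r n := mul_nonneg h2.le (hS.r_pos n).le
  rw [q]
  linarith

theorem isSymbol_β : IsSymbol (fun n _ => Real.exp (-S.q n)) S.β := by
  have h1 := (hS.isSymbol_cut_indicator 1 (-1)).mul_one (hS.isSymbol_cut (-1) 7)
  refine (h1.mul hS.isSymbol_exp_phase).mono fun n t =>
    indicator_one_mul_le (Real.exp_nonneg _) fun ht => Real.exp_le_exp.2 (hS.phase_le ?_)
  have ht' : 0 ≤ 1 * S.s n t + -1 := ht
  linarith

end Admissible

end Cascade

/-! ### The solution and the lower order coefficients as series of symbols -/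

namespace Cascade

variable (S : Cascade)

/-- The four switchings of a step: `x₂` mode on, `x₂` mode off, old `x₁` mode off, new `x₁` mode on.
The exponents are the logarithms of the weaker amplitude over the dominating one at the relevant
times. -/
noncomputable def gain₁ : ℕ → ℝ → ℝ := S.gain 1 (-1) (fun n => -(8 * S.p n)) (fun _ => 0)
noncomputable def gain₂ : ℕ → ℝ → ℝ := S.gain (-1) 7 (fun n => -(8 * S.p n)) S.d
noncomputable def gain₃ : ℕ → ℝ → ℝ := S.gain (-1) 4 (fun n => -S.p n) (fun _ => 0)
noncomputable def gain₄ : ℕ → ℝ → ℝ := S.gain 1 (-4) (fun n => -S.p n) (fun n => -S.d n)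

noncomputable def ratio₁ : ℕ → ℝ → ℝ := S.ratio 1 (-1) (fun n => -(8 * S.p n)) (fun _ => 0)
noncomputable def ratio₂ : ℕ → ℝ → ℝ := S.ratio (-1) 7 (fun n => -(8 * S.p n)) S.d
noncomputable def ratio₃ : ℕ → ℝ → ℝ := S.ratio (-1) 4 (fun n => -S.p n) (fun _ => 0)
noncomputable def ratio₄ : ℕ → ℝ → ℝ := S.ratio 1 (-4) (fun n => -S.p n) (fun n => -S.d n)

noncomputable def cosX (n : ℕ) (x : ℝ × ℝ × ℝ) : ℝ := Real.cos (S.k n * x.2.1)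
noncomputable def sinX (n : ℕ) (x : ℝ × ℝ × ℝ) : ℝ := Real.sin (S.k n * x.2.1)
noncomputable def cosY (n : ℕ) (x : ℝ × ℝ × ℝ) : ℝ := Real.cos (S.k n * x.2.2)
noncomputable def sinY (n : ℕ) (x : ℝ × ℝ × ℝ) : ℝ := Real.sin (S.k n * x.2.2)

noncomputable def uTerm (n : ℕ) (x : ℝ × ℝ × ℝ) : ℝ :=
  S.α n x.1 * S.cosX (n + 1) x + S.β n x.1 * S.cosY n x

noncomputable def b₁Term (n : ℕ) (x : ℝ × ℝ × ℝ) : ℝ :=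
  S.gain₁ n x.1 * S.cosY n x * (S.sinX n x * (S.k n)⁻¹) +
    S.gain₂ n x.1 * S.cosY n x * (S.sinX (n + 1) x * (S.k (n + 1))⁻¹) -
    S.gain₃ n x.1 * S.cosX n x * (S.ratio₃ n x.1 * (S.sinX n x * (S.k n)⁻¹)) -
    S.gain₄ n x.1 * S.cosX (n + 1) x * (S.ratio₄ n x.1 * (S.sinX (n + 1) x * (S.k (n + 1))⁻¹))

noncomputable def b₂Term (n : ℕ) (x : ℝ × ℝ × ℝ) : ℝ :=
  S.gain₃ n x.1 * S.cosX n x * (S.sinY n x * (S.k n)⁻¹) +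
    S.gain₄ n x.1 * S.cosX (n + 1) x * (S.sinY n x * (S.k n)⁻¹) -
    S.gain₁ n x.1 * S.cosY n x * (S.ratio₁ n x.1 * (S.sinY n x * (S.k n)⁻¹)) -
    S.gain₂ n x.1 * S.cosY n x * (S.ratio₂ n x.1 * (S.sinY n x * (S.k n)⁻¹))

noncomputable def cTerm (n : ℕ) (x : ℝ × ℝ × ℝ) : ℝ :=
  -(S.gain₁ n x.1 * S.cosY n x * (S.cosX n x - S.ratio₁ n x.1 * S.cosY n x)) -
    S.gain₂ n x.1 * S.cosY n x * (S.cosX (n + 1) x - S.ratio₂ n x.1 * S.cosY n x) -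
    S.gain₃ n x.1 * S.cosX n x * (S.cosY n x - S.ratio₃ n x.1 * S.cosX n x) -
    S.gain₄ n x.1 * S.cosX (n + 1) x * (S.cosY n x - S.ratio₄ n x.1 * S.cosX (n + 1) x)

/-- The solution. -/
noncomputable def u (x : ℝ × ℝ × ℝ) : ℝ := ∑' n, S.uTerm n x
noncomputable def b₁ (x : ℝ × ℝ × ℝ) : ℝ := ∑' n, S.b₁Term n x
noncomputable def b₂ (x : ℝ × ℝ × ℝ) : ℝ := ∑' n, S.b₂Term n x
noncomputable def c (x : ℝ × ℝ × ℝ) : ℝ := ∑' n, S.cTerm n x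

variable {S}

theorem isSymbol_comp_time {w : ℕ → ℝ} {f : ℕ → ℝ → ℝ} (hf : IsSymbol (fun n _ => w n) f) :
    IsSymbol (fun n _ => w n) (fun n (x : ℝ × ℝ × ℝ) => f n x.1) :=
  hf.comp_clm (ContinuousLinearMap.fst ℝ ℝ (ℝ × ℝ))

namespace Admissible

variable (hS : S.Admissible)
include hS

theorem isSymbol_trig {g : ℝ → ℝ} (hg : IsSymbol (fun _ _ => 1) (fun _ => g))
    (L : ℝ × ℝ × ℝ →L[ℝ] ℝ) : IsSymbol (fun _ _ => 1) (fun n x => g (S.k n * L x)) := by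
  simpa only [add_zero] using (hg.comp_affine (b := fun _ => 0) hS.k_poly).comp_clm L

theorem isSymbol_cosX : IsSymbol (fun _ _ => 1) S.cosX :=
  hS.isSymbol_trig isSymbol_cos
    ((ContinuousLinearMap.fst ℝ ℝ ℝ).comp (ContinuousLinearMap.snd ℝ ℝ (ℝ × ℝ)))

theorem isSymbol_sinX : IsSymbol (fun _ _ => 1) S.sinX :=
  hS.isSymbol_trig isSymbol_sin
    ((ContinuousLinearMap.fst ℝ ℝ ℝ).comp (ContinuousLinearMap.snd ℝ ℝ (ℝ × ℝ)))

theorem isSymbol_cosY : IsSymbol (fun _ _ => 1) S.cosY :=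
  hS.isSymbol_trig isSymbol_cos
    ((ContinuousLinearMap.snd ℝ ℝ ℝ).comp (ContinuousLinearMap.snd ℝ ℝ (ℝ × ℝ)))

theorem isSymbol_sinY : IsSymbol (fun _ _ => 1) S.sinY :=
  hS.isSymbol_trig isSymbol_sin
    ((ContinuousLinearMap.snd ℝ ℝ ℝ).comp (ContinuousLinearMap.snd ℝ ℝ (ℝ × ℝ)))

theorem isSymbol_inv_k :
    IsSymbol (fun _ _ => 1) (fun n (_ : ℝ × ℝ × ℝ) => (S.k n)⁻¹) :=
  IsSymbol.const <| PolyLE.self fun n _ => by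
    have := hS.one_le_k n
    rw [abs_of_nonneg (by positivity)]
    exact inv_le_one_of_one_le₀ this

theorem le₁ (n : ℕ) (t : ℝ) (_ : 0 ≤ 1 * S.s n t + -1) :
    -(8 * S.p n) + 0 * (t - S.a n) ≤ -S.p n := by
  linarith [hS.one_le_p n]

/-- In rescaled time the exponent is `p n * (s - 8)`, hence at most `-p n` while the cutoff lives,
up to `s = 7`. This is why `J` ends at -8. -/
theorem le₂ (n : ℕ) (t : ℝ) (ht : 0 ≤ -1 * S.s n t + 7) :
    -(8 * S.p n) + S.d n * (t - S.a n) ≤ -S.p n := by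
  rw [← hS.r_mul_s, ← mul_assoc, d_mul_r]
  have h := hS.one_le_p n
  have : S.p n * S.s n t ≤ S.p n * 7 := by
    gcongr
    linarith
  linarith

omit hS in
theorem le₃ (n : ℕ) (t : ℝ) (_ : 0 ≤ -1 * S.s n t + 4) :
    -S.p n + 0 * (t - S.a n) ≤ -S.p n := by simp

theorem le₄ (n : ℕ) (t : ℝ) (ht : 0 ≤ 1 * S.s n t + -4) :
    -S.p n + -S.d n * (t - S.a n) ≤ -S.p n := by
  rw [← hS.r_mul_s, neg_mul, ← mul_assoc, d_mul_r]
  have h := hS.one_le_p n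
  have : 0 ≤ S.p n * S.s n t := mul_nonneg (by linarith) (by linarith)
  linarith

omit hS in
theorem zero_poly : PolyLE (fun _ (_ : ℝ) => |(0 : ℝ)|) (fun _ _ => 1) :=
  PolyLE.self (by simp)

theorem neg_d_poly : PolyLE (fun n (_ : ℝ) => |-S.d n|) (fun _ _ => 1) := by
  simpa only [abs_neg] using hS.d_poly

theorem weaken {f : ℕ → ℝ × ℝ × ℝ → ℝ} (hf : IsSymbol (fun n _ => Real.exp (-S.p n)) f) :
    IsSymbol (fun _ _ => 1) f :=
  hf.mono fun n _ => by
    rw [Real.exp_le_one_iff]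
    linarith [hS.one_le_p n]

theorem isSymbol_gain₁ :
    IsSymbol (fun n _ => Real.exp (-S.p n)) (fun n (x : ℝ × ℝ × ℝ) => S.gain₁ n x.1) :=
  isSymbol_comp_time (hS.isSymbol_gain zero_poly hS.le₁)

theorem isSymbol_gain₂ :
    IsSymbol (fun n _ => Real.exp (-S.p n)) (fun n (x : ℝ × ℝ × ℝ) => S.gain₂ n x.1) :=
  isSymbol_comp_time (hS.isSymbol_gain hS.d_poly hS.le₂)

theorem isSymbol_gain₃ :
    IsSymbol (fun n _ => Real.exp (-S.p n)) (fun n (x : ℝ × ℝ × ℝ) => S.gain₃ n x.1) :=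
  isSymbol_comp_time (hS.isSymbol_gain zero_poly le₃)

theorem isSymbol_gain₄ :
    IsSymbol (fun n _ => Real.exp (-S.p n)) (fun n (x : ℝ × ℝ × ℝ) => S.gain₄ n x.1) :=
  isSymbol_comp_time (hS.isSymbol_gain hS.neg_d_poly hS.le₄)

theorem isSymbol_ratio₁ : IsSymbol (fun _ _ => 1) (fun n (x : ℝ × ℝ × ℝ) => S.ratio₁ n x.1) :=
  hS.weaken (isSymbol_comp_time (hS.isSymbol_ratio zero_poly hS.le₁))

theorem isSymbol_ratio₂ : IsSymbol (fun _ _ => 1) (fun n (x : ℝ × ℝ × ℝ) => S.ratio₂ n x.1) :=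
  hS.weaken (isSymbol_comp_time (hS.isSymbol_ratio hS.d_poly hS.le₂))

theorem isSymbol_ratio₃ : IsSymbol (fun _ _ => 1) (fun n (x : ℝ × ℝ × ℝ) => S.ratio₃ n x.1) :=
  hS.weaken (isSymbol_comp_time (hS.isSymbol_ratio zero_poly le₃))

theorem isSymbol_ratio₄ : IsSymbol (fun _ _ => 1) (fun n (x : ℝ × ℝ × ℝ) => S.ratio₄ n x.1) :=
  hS.weaken (isSymbol_comp_time (hS.isSymbol_ratio hS.neg_d_poly hS.le₄))

theorem isSymbol_uTerm : IsSymbol (fun n _ => Real.exp (-S.q n)) S.uTerm :=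
  ((isSymbol_comp_time hS.isSymbol_α).mul_one hS.isSymbol_cosX.shift).add
    ((isSymbol_comp_time hS.isSymbol_β).mul_one hS.isSymbol_cosY)

theorem isSymbol_b₁Term : IsSymbol (fun n _ => Real.exp (-S.p n)) S.b₁Term := by
  have hX := hS.isSymbol_sinX.mul_one hS.isSymbol_inv_k
  exact ((((hS.isSymbol_gain₁.mul_one hS.isSymbol_cosY).mul_one hX).add
    ((hS.isSymbol_gain₂.mul_one hS.isSymbol_cosY).mul_one hX.shift)).sub
    ((hS.isSymbol_gain₃.mul_one hS.isSymbol_cosX).mul_one (hS.isSymbol_ratio₃.mul_one hX))).sub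
    ((hS.isSymbol_gain₄.mul_one hS.isSymbol_cosX.shift).mul_one
      (hS.isSymbol_ratio₄.mul_one hX.shift))

theorem isSymbol_b₂Term : IsSymbol (fun n _ => Real.exp (-S.p n)) S.b₂Term := by
  have hY := hS.isSymbol_sinY.mul_one hS.isSymbol_inv_k
  exact ((((hS.isSymbol_gain₃.mul_one hS.isSymbol_cosX).mul_one hY).add
    ((hS.isSymbol_gain₄.mul_one hS.isSymbol_cosX.shift).mul_one hY)).sub
    ((hS.isSymbol_gain₁.mul_one hS.isSymbol_cosY).mul_one (hS.isSymbol_ratio₁.mul_one hY))).sub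
    ((hS.isSymbol_gain₂.mul_one hS.isSymbol_cosY).mul_one (hS.isSymbol_ratio₂.mul_one hY))

theorem isSymbol_cTerm : IsSymbol (fun n _ => Real.exp (-S.p n)) S.cTerm := by
  have hX := hS.isSymbol_cosX
  have hY := hS.isSymbol_cosY
  exact ((((hS.isSymbol_gain₁.mul_one hY).mul_one
      (hX.sub (hS.isSymbol_ratio₁.mul_one hY))).neg.sub
    ((hS.isSymbol_gain₂.mul_one hY).mul_one (hX.shift.sub (hS.isSymbol_ratio₂.mul_one hY)))).sub
    ((hS.isSymbol_gain₃.mul_one hX).mul_one (hY.sub (hS.isSymbol_ratio₃.mul_one hX)))).sub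
    ((hS.isSymbol_gain₄.mul_one hX.shift).mul_one (hY.sub (hS.isSymbol_ratio₄.mul_one hX.shift)))

theorem isSmoothBounded_u : IsSmoothBounded S.u :=
  hS.isSymbol_uTerm.isSmoothBounded_tsum hS.summable_q

theorem contDiff_u : ContDiff ℝ ∞ S.u :=
  (hS.isSymbol_uTerm.contDiff_tsum_and_bounded hS.summable_q).1

theorem isSmoothBounded_b₁ : IsSmoothBounded S.b₁ :=
  hS.isSymbol_b₁Term.isSmoothBounded_tsum hS.summable_p

theorem isSmoothBounded_b₂ : IsSmoothBounded S.b₂ :=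
  hS.isSymbol_b₂Term.isSmoothBounded_tsum hS.summable_p

theorem isSmoothBounded_c : IsSmoothBounded S.c :=
  hS.isSymbol_cTerm.isSmoothBounded_tsum hS.summable_p

end Admissible

end Cascade

/-! ### Compensation identity and the principal part on Fourier modes -/

/-- A linear combination, with explicit coefficients, of the function
`V * (C + θ * E * c)` and of its derivatives equals the error term `g * E * V * c`, where `(C, S)`
and `(c, s)` are the cosines and sines of the two modes. -/
theorem mode_compensation {k κ V E g θ C S c s : ℝ} (hk : k ≠ 0) (hκ : κ ≠ 0)
    (hD : 1 - (θ * E) ^ 2 ≠ 0) (hC : S ^ 2 + C ^ 2 = 1) (hc : s ^ 2 + c ^ 2 = 1) :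
    g * (E * V) * c + g * E * (1 - (θ * E) ^ 2)⁻¹ * c * (S * k⁻¹) * (-(k * V * S)) -
      g * E * (1 - (θ * E) ^ 2)⁻¹ * c * (θ * E * (s * κ⁻¹)) * (-(κ * (θ * (E * V)) * s)) -
      g * E * (1 - (θ * E) ^ 2)⁻¹ * c * (C - θ * E * c) * (V * C + θ * (E * V) * c) = 0 := by
  have h1 : k⁻¹ * k = 1 := inv_mul_cancel₀ hk
  have h2 : κ⁻¹ * κ = 1 := inv_mul_cancel₀ hκ
  have h3 : (1 - (θ * E) ^ 2)⁻¹ * (1 - (θ * E) ^ 2) = 1 := inv_mul_cancel₀ hD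
  set D := (1 - (θ * E) ^ 2)⁻¹
  -- The zeroth order term contributes `C ^ 2 - (θ * E) ^ 2 * c ^ 2` and the gradient terms add the
  -- matching squares of sines. Their sum `1 - (θ * E) ^ 2` cancels against its inverse.
  linear_combination (-g * E * D * c * S ^ 2 * V) * h1 +
    (g * E * D * c * θ ^ 2 * E ^ 2 * V * s ^ 2) * h2 + (-g * E * V * c) * h3 +
    (-g * E * V * c * D) * hC + (g * E * V * c * D * θ ^ 2 * E ^ 2) * hc

theorem neg_one_pow_mul_iteratedDeriv_cos (m : ℕ) (k k' A A' : ℝ) (y : ℝ) :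
    (-1) ^ m * iteratedDeriv (2 * m) (fun y => A * Real.cos (k * y) + A' * Real.cos (k' * y)) y =
      k ^ (2 * m) * (A * Real.cos (k * y)) + k' ^ (2 * m) * (A' * Real.cos (k' * y)) := by
  induction m generalizing A A' with
  | zero => simp
  | succ m ih =>
    have hm : 2 * (m + 1) = 2 * m + 1 + 1 := by ring
    have hl : ∀ k y : ℝ, HasDerivAt (fun y => k * y) k y := fun k y => by
      simpa using (hasDerivAt_id y).const_mul k
    have e1 : deriv (fun y => A * Real.cos (k * y) + A' * Real.cos (k' * y)) =
        fun y => A * (-Real.sin (k * y) * k) + A' * (-Real.sin (k' * y) * k') := by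
      ext y
      exact (((hl k y).cos.const_mul A).add ((hl k' y).cos.const_mul A')).deriv
    have e2 : deriv (fun y => A * (-Real.sin (k * y) * k) + A' * (-Real.sin (k' * y) * k')) =
        fun y => (-(k ^ 2 * A)) * Real.cos (k * y) + (-(k' ^ 2 * A')) * Real.cos (k' * y) := by
      ext y
      have := ((((hl k y).sin.neg.mul_const k).const_mul A).add
        (((hl k' y).sin.neg.mul_const k').const_mul A')).deriv
      refine Eq.trans this ?_
      ring
    rw [hm, iteratedDeriv_succ', iteratedDeriv_succ', e1, e2]
    have := ih (-(k ^ 2 * A)) (-(k' ^ 2 * A'))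
    rw [pow_succ, mul_assoc, mul_comm (-1 : ℝ), ← mul_assoc, this]
    ring

/-- `B` stands for the modes in the frozen variable; it is killed because the order is positive. -/
theorem neg_one_pow_mul_iteratedDeriv_cos_add {m : ℕ} (hm : 1 ≤ m) (k k' A A' B : ℝ) (y : ℝ) :
    (-1) ^ m *
        iteratedDeriv (2 * m) (fun y => A * Real.cos (k * y) + B + A' * Real.cos (k' * y)) y =
      k ^ (2 * m) * (A * Real.cos (k * y)) + k' ^ (2 * m) * (A' * Real.cos (k' * y)) := by
  rw [← neg_one_pow_mul_iteratedDeriv_cos]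
  congr 1
  obtain ⟨j, hj⟩ : ∃ j, 2 * m = j + 1 := ⟨2 * m - 1, by lia⟩
  rw [hj, iteratedDeriv_succ', iteratedDeriv_succ']
  have e : (fun y => A * Real.cos (k * y) + B + A' * Real.cos (k' * y)) =
      fun y => (A * Real.cos (k * y) + A' * Real.cos (k' * y)) + B := by
    ext y; ring
  have e' : deriv (fun y => A * Real.cos (k * y) + B + A' * Real.cos (k' * y)) =
      deriv (fun y => A * Real.cos (k * y) + A' * Real.cos (k' * y)) := by
    rw [e, deriv_add_const']
  rw [e']

/-! ### Cancellation of the errors within one step -/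

namespace Cascade

variable {S : Cascade}

theorem cut_eq_zero {e b : ℝ} {n : ℕ} {t : ℝ} (h : e * S.s n t + b ≤ 0) : S.cut e b n t = 0 :=
  Real.smoothTransition.zero_of_nonpos h

theorem cut_eq_one {e b : ℝ} {n : ℕ} {t : ℝ} (h : 1 ≤ e * S.s n t + b) : S.cut e b n t = 1 :=
  Real.smoothTransition.one_of_one_le h

theorem hasDerivAt_cut (e b : ℝ) (n : ℕ) (t : ℝ) : HasDerivAt (S.cut e b n)
    (deriv Real.smoothTransition (e * S.s n t + b) * (e * (1 / S.r n))) t := by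
  have h1 : HasDerivAt (fun t => e * S.s n t + b) (e * (1 / S.r n)) t :=
    ((((hasDerivAt_id t).sub_const (S.a n)).div_const (S.r n)).const_mul e).add_const b
  have h2 : Differentiable ℝ Real.smoothTransition :=
    (Real.smoothTransition.contDiff (n := ⊤)).differentiable (by simp)
  exact (h2 (e * S.s n t + b)).hasDerivAt.comp t h1

theorem deriv_cut_eq_zero {e b : ℝ} {n : ℕ} {t : ℝ}
    (h : e * S.s n t + b ≤ 0 ∨ 1 ≤ e * S.s n t + b) : deriv (S.cut e b n) t = 0 := by
  rw [(hasDerivAt_cut e b n t).deriv]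
  rcases h with h | h
  · rw [Real.smoothTransition.deriv_eq_zero_of_nonpos h, zero_mul]
  · rw [Real.smoothTransition.deriv_eq_zero_of_one_le h, zero_mul]

theorem gain_eq_zero {e b : ℝ} {A B : ℕ → ℝ} {n : ℕ} {t : ℝ}
    (h : e * S.s n t + b ≤ 0 ∨ 1 ≤ e * S.s n t + b) : S.gain e b A B n t = 0 := by
  rw [gain, deriv_cut_eq_zero h, zero_mul, zero_mul]

/-- The recursion for `q` is chosen so that `v n` and `v (n + 1)` agree at the start `a n` of step
`n`. -/
theorem v_succ (n : ℕ) (t : ℝ) :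
    S.v (n + 1) t = Real.exp (-S.d n * (t - S.a n)) * S.v n t := by
  rw [v, v, ← Real.exp_add, q, a_succ, d]
  congr 1
  ring

theorem exp_phase (n : ℕ) (t : ℝ) :
    Real.exp (S.phase n t) = Real.exp (S.p n * S.J n t) * S.v n t := by
  rw [v, ← Real.exp_add, phase]
  congr 1
  ring

namespace Admissible

variable (hS : S.Admissible)
include hS

/-- In each step, the lower order terms compensate the error of the principal part. -/
theorem lower_order_identity (n : ℕ) (t : ℝ) (x : ℝ × ℝ) :
    deriv (S.cut (-1) 4 n) t * S.v n t * S.cosX n (t, x) +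
    (deriv (S.cut 1 (-1) n) t * S.cut (-1) 7 n t + S.cut 1 (-1) n t * deriv (S.cut (-1) 7 n) t) *
      Real.exp (S.phase n t) * S.cosY n (t, x) +
    deriv (S.cut 1 (-4) n) t * S.v (n + 1) t * S.cosX (n + 1) (t, x) +
    S.b₁Term n (t, x) * (-(S.k n * (S.cut (-1) 4 n t * S.v n t) * S.sinX n (t, x)) -
      S.k (n + 1) * (S.cut 1 (-4) n t * S.v (n + 1) t) * S.sinX (n + 1) (t, x)) +
    S.b₂Term n (t, x) * (-(S.k n * S.β n t * S.sinY n (t, x))) +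
    S.cTerm n (t, x) * (S.cut (-1) 4 n t * S.v n t * S.cosX n (t, x) + S.β n t * S.cosY n (t, x) +
      S.cut 1 (-4) n t * S.v (n + 1) t * S.cosX (n + 1) (t, x)) = 0 := by
  have hk : S.k n ≠ 0 := by linarith [hS.one_le_k n]
  have hk' : S.k (n + 1) ≠ 0 := by linarith [hS.one_le_k (n + 1)]
  have hX : S.sinX n (t, x) ^ 2 + S.cosX n (t, x) ^ 2 = 1 := Real.sin_sq_add_cos_sq _
  have hX' : S.sinX (n + 1) (t, x) ^ 2 + S.cosX (n + 1) (t, x) ^ 2 = 1 := Real.sin_sq_add_cos_sq _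
  have hY : S.sinY n (t, x) ^ 2 + S.cosY n (t, x) ^ 2 = 1 := Real.sin_sq_add_cos_sq _
  have hD₁ := hS.half_le_one_sub_ratio_sq hS.le₁ n t
  have hD₂ := hS.half_le_one_sub_ratio_sq hS.le₂ n t
  have hD₃ := hS.half_le_one_sub_ratio_sq le₃ n t
  have hD₄ := hS.half_le_one_sub_ratio_sq hS.le₄ n t
  rw [b₁Term, b₂Term, cTerm, β]
  simp only
  -- Split at rescaled times 2 to 6. On each piece at most one cutoff varies, and where one varies
  -- `J` is constant; on `[2, 3]` and `[5, 6]`, where `J` moves, no cutoff does.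
  rcases le_total (S.s n t) 2 with h2 | h2
  · have g2 : S.gain₂ n t = 0 := gain_eq_zero (Or.inr (by linarith))
    have g3 : S.gain₃ n t = 0 := gain_eq_zero (Or.inr (by linarith))
    have g4 : S.gain₄ n t = 0 := gain_eq_zero (Or.inl (by linarith))
    have d2 : deriv (S.cut (-1) 7 n) t = 0 := deriv_cut_eq_zero (Or.inr (by linarith))
    have d3 : deriv (S.cut (-1) 4 n) t = 0 := deriv_cut_eq_zero (Or.inr (by linarith))
    have d4 : deriv (S.cut 1 (-4) n) t = 0 := deriv_cut_eq_zero (Or.inl (by linarith))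
    have c2 : S.cut (-1) 7 n t = 1 := cut_eq_one (by linarith)
    have c3 : S.cut (-1) 4 n t = 1 := cut_eq_one (by linarith)
    have c4 : S.cut 1 (-4) n t = 0 := cut_eq_zero (by linarith)
    have hJ : S.J n t = -8 := by
      rw [J, cut_eq_zero (by linarith), cut_eq_zero (by linarith)]; ring
    have hW : Real.exp (S.phase n t) =
        Real.exp (-(8 * S.p n) + 0 * (t - S.a n)) * S.v n t := by
      rw [exp_phase, hJ]; ring_nf
    rw [g2, g3, g4, d2, d3, d4, c2, c3, c4, hW]
    have := mode_compensation (V := S.v n t) (E := Real.exp (-(8 * S.p n) + 0 * (t - S.a n)))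
      (g := deriv (S.cut 1 (-1) n) t) (θ := S.cut 1 (-1) n t) hk hk (by rw [ratio] at hD₁; linarith)
      hX hY
    rw [gain₁, ratio₁, gain, ratio]
    linear_combination this
  rcases le_total (S.s n t) 3 with h3 | h3
  · have g1 : S.gain₁ n t = 0 := gain_eq_zero (Or.inr (by linarith))
    have g2 : S.gain₂ n t = 0 := gain_eq_zero (Or.inr (by linarith))
    have g3 : S.gain₃ n t = 0 := gain_eq_zero (Or.inr (by linarith))
    have g4 : S.gain₄ n t = 0 := gain_eq_zero (Or.inl (by linarith))
    have d1 : deriv (S.cut 1 (-1) n) t = 0 := deriv_cut_eq_zero (Or.inr (by linarith))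
    have d2 : deriv (S.cut (-1) 7 n) t = 0 := deriv_cut_eq_zero (Or.inr (by linarith))
    have d3 : deriv (S.cut (-1) 4 n) t = 0 := deriv_cut_eq_zero (Or.inr (by linarith))
    have d4 : deriv (S.cut 1 (-4) n) t = 0 := deriv_cut_eq_zero (Or.inl (by linarith))
    rw [g1, g2, g3, g4, d1, d2, d3, d4]
    ring
  have g1 : S.gain₁ n t = 0 := gain_eq_zero (Or.inr (by linarith))
  have d1 : deriv (S.cut 1 (-1) n) t = 0 := deriv_cut_eq_zero (Or.inr (by linarith))
  have c1 : S.cut 1 (-1) n t = 1 := cut_eq_one (by linarith)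
  rcases le_total (S.s n t) 5 with h5 | h5
  · have g2 : S.gain₂ n t = 0 := gain_eq_zero (Or.inr (by linarith))
    have d2 : deriv (S.cut (-1) 7 n) t = 0 := deriv_cut_eq_zero (Or.inr (by linarith))
    have c2 : S.cut (-1) 7 n t = 1 := cut_eq_one (by linarith)
    have hJ : S.J n t = 1 := by
      rw [J, cut_eq_one (by linarith), cut_eq_zero (by linarith)]; ring
    rcases le_total (S.s n t) 4 with h4 | h4
    · have g4 : S.gain₄ n t = 0 := gain_eq_zero (Or.inl (by linarith))
      have d4 : deriv (S.cut 1 (-4) n) t = 0 := deriv_cut_eq_zero (Or.inl (by linarith))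
      have c4 : S.cut 1 (-4) n t = 0 := cut_eq_zero (by linarith)
      -- On `[3, 5]` the `x₂` mode dominates, so the roles of the two variables are exchanged.
      have hV : S.v n t = Real.exp (-S.p n + 0 * (t - S.a n)) * Real.exp (S.phase n t) := by
        rw [exp_phase, hJ, ← mul_assoc, ← Real.exp_add]
        ring_nf
        simp
      rw [g1, g2, g4, d1, d2, d4, c1, c2, c4, hV]
      have := mode_compensation (V := Real.exp (S.phase n t))
        (E := Real.exp (-S.p n + 0 * (t - S.a n)))
        (g := deriv (S.cut (-1) 4 n) t) (θ := S.cut (-1) 4 n t) hk hk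
        (by rw [ratio] at hD₃; linarith) hY hX
      rw [gain₃, ratio₃, gain, ratio]
      linear_combination this
    · have g3 : S.gain₃ n t = 0 := gain_eq_zero (Or.inl (by linarith))
      have d3 : deriv (S.cut (-1) 4 n) t = 0 := deriv_cut_eq_zero (Or.inl (by linarith))
      have c3 : S.cut (-1) 4 n t = 0 := cut_eq_zero (by linarith)
      have hV : S.v (n + 1) t =
          Real.exp (-S.p n + -S.d n * (t - S.a n)) * Real.exp (S.phase n t) := by
        rw [v_succ, exp_phase, hJ, ← mul_assoc, ← Real.exp_add]
        ring_nf
      rw [g1, g2, g3, d1, d2, d3, c1, c2, c3, hV]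
      have := mode_compensation (V := Real.exp (S.phase n t))
        (E := Real.exp (-S.p n + -S.d n * (t - S.a n)))
        (g := deriv (S.cut 1 (-4) n) t) (θ := S.cut 1 (-4) n t) hk hk'
        (by rw [ratio] at hD₄; linarith) hY hX'
      rw [gain₄, ratio₄, gain, ratio]
      linear_combination this
  have g3 : S.gain₃ n t = 0 := gain_eq_zero (Or.inl (by linarith))
  have g4 : S.gain₄ n t = 0 := gain_eq_zero (Or.inr (by linarith))
  have d3 : deriv (S.cut (-1) 4 n) t = 0 := deriv_cut_eq_zero (Or.inl (by linarith))
  have d4 : deriv (S.cut 1 (-4) n) t = 0 := deriv_cut_eq_zero (Or.inr (by linarith))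
  have c3 : S.cut (-1) 4 n t = 0 := cut_eq_zero (by linarith)
  have c4 : S.cut 1 (-4) n t = 1 := cut_eq_one (by linarith)
  rcases le_total (S.s n t) 6 with h6 | h6
  · have g2 : S.gain₂ n t = 0 := gain_eq_zero (Or.inr (by linarith))
    have d2 : deriv (S.cut (-1) 7 n) t = 0 := deriv_cut_eq_zero (Or.inr (by linarith))
    rw [g1, g2, g3, g4, d1, d2, d3, d4]
    ring
  · have hJ : S.J n t = -8 := by
      rw [J, cut_eq_one (by linarith), cut_eq_one (by linarith)]; ring
    have hW : Real.exp (S.phase n t) =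
        Real.exp (-(8 * S.p n) + S.d n * (t - S.a n)) * S.v (n + 1) t := by
      rw [exp_phase, hJ, v_succ, ← mul_assoc, ← Real.exp_add]
      ring_nf
    rw [g1, g3, g4, d1, d3, d4, c1, c3, c4, hW]
    have := mode_compensation (V := S.v (n + 1) t)
      (E := Real.exp (-(8 * S.p n) + S.d n * (t - S.a n)))
      (g := deriv (S.cut (-1) 7 n) t) (θ := S.cut (-1) 7 n t) hk' hk
      (by rw [ratio] at hD₂; linarith) hX' hY
    rw [gain₂, ratio₂, gain, ratio]
    linear_combination this

/-! ### Localisation in time: one active step at each instant -/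

theorem a_mono : Monotone S.a :=
  monotone_nat_of_le_succ fun n => by
    rw [a_succ]
    linarith [hS.r_pos n]

theorem s_nonpos {n : ℕ} {t : ℝ} (ht : t ≤ S.a n) : S.s n t ≤ 0 :=
  div_nonpos_of_nonpos_of_nonneg (by linarith) (hS.r_pos n).le

theorem eight_le_s {n j : ℕ} (hj : n < j) {t : ℝ} (ht : S.a j ≤ t) : 8 ≤ S.s n t := by
  have h := hS.a_mono (Nat.succ_le_of_lt hj)
  rw [Nat.succ_eq_add_one, a_succ] at h
  rw [s, le_div_iff₀ (hS.r_pos n)]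
  linarith

theorem s_nonpos_or_eight_le {n j : ℕ} (hj : j ≠ n) {t : ℝ} (h1 : S.a n ≤ t)
    (h2 : t ≤ S.a (n + 1)) : S.s j t ≤ 0 ∨ 8 ≤ S.s j t := by
  rcases lt_or_gt_of_ne hj with h | h
  · exact Or.inr (hS.eight_le_s h h1)
  · exact Or.inl (hS.s_nonpos (h2.trans (hS.a_mono h)))

omit hS in
theorem gains_eq_zero {j : ℕ} {t : ℝ} (h : S.s j t ≤ 0 ∨ 8 ≤ S.s j t) :
    S.gain₁ j t = 0 ∧ S.gain₂ j t = 0 ∧ S.gain₃ j t = 0 ∧ S.gain₄ j t = 0 := by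
  rcases h with h | h
  · exact ⟨gain_eq_zero (Or.inl (by linarith)), gain_eq_zero (Or.inr (by linarith)),
      gain_eq_zero (Or.inr (by linarith)), gain_eq_zero (Or.inl (by linarith))⟩
  · exact ⟨gain_eq_zero (Or.inr (by linarith)), gain_eq_zero (Or.inl (by linarith)),
      gain_eq_zero (Or.inl (by linarith)), gain_eq_zero (Or.inr (by linarith))⟩

theorem b₁_eq {n : ℕ} {t : ℝ} (h1 : S.a n ≤ t) (h2 : t ≤ S.a (n + 1)) (x : ℝ × ℝ) :
    S.b₁ (t, x) = S.b₁Term n (t, x) :=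
  tsum_eq_single n fun j hj => by
    obtain ⟨g1, g2, g3, g4⟩ := gains_eq_zero (hS.s_nonpos_or_eight_le hj h1 h2)
    simp [b₁Term, g1, g2, g3, g4]

theorem b₂_eq {n : ℕ} {t : ℝ} (h1 : S.a n ≤ t) (h2 : t ≤ S.a (n + 1)) (x : ℝ × ℝ) :
    S.b₂ (t, x) = S.b₂Term n (t, x) :=
  tsum_eq_single n fun j hj => by
    obtain ⟨g1, g2, g3, g4⟩ := gains_eq_zero (hS.s_nonpos_or_eight_le hj h1 h2)
    simp [b₂Term, g1, g2, g3, g4]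

theorem c_eq {n : ℕ} {t : ℝ} (h1 : S.a n ≤ t) (h2 : t ≤ S.a (n + 1)) (x : ℝ × ℝ) :
    S.c (t, x) = S.cTerm n (t, x) :=
  tsum_eq_single n fun j hj => by
    obtain ⟨g1, g2, g3, g4⟩ := gains_eq_zero (hS.s_nonpos_or_eight_le hj h1 h2)
    simp [cTerm, g1, g2, g3, g4]

/-- The three modes that make up the solution near the `(n + 1)`-st step. -/
theorem u_eq_near {n : ℕ} {t : ℝ} (h1 : S.a (n + 1) - S.r n < t)
    (h2 : t < S.a (n + 2) + S.r (n + 2)) (x : ℝ × ℝ) :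
    S.u (t, x) = S.cut (-1) 4 (n + 1) t * S.v (n + 1) t * S.cosX (n + 1) (t, x) +
      S.β (n + 1) t * S.cosY (n + 1) (t, x) +
      S.cut 1 (-4) (n + 1) t * S.v (n + 2) t * S.cosX (n + 2) (t, x) := by
  have e1 : 7 ≤ S.s n t := by
    rw [a_succ] at h1
    rw [s, le_div_iff₀ (hS.r_pos n)]
    linarith
  have e2 : S.s (n + 2) t ≤ 1 := by
    rw [s, div_le_one (hS.r_pos _)]
    linarith
  have e3 : ∀ j ≤ n, 7 ≤ S.s j t := by
    intro j hj
    rcases hj.eq_or_lt with rfl | hj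
    · exact e1
    · have := hS.eight_le_s (t := t) hj (by
        rw [a_succ] at h1
        linarith [hS.r_pos n])
      linarith
  have e4 : ∀ j, n + 2 ≤ j → S.s j t ≤ 1 := by
    intro j hj
    rcases hj.eq_or_lt with rfl | hj
    · exact e2
    · have h3 := hS.a_mono (Nat.succ_le_of_lt hj)
      rw [Nat.succ_eq_add_one, a_succ] at h3
      have := hS.s_nonpos (n := j) (t := t) (by linarith [hS.r_pos (n + 2)])
      linarith
  have hβ : ∀ j, j ≠ n + 1 → S.β j t = 0 := by
    intro j hj
    rcases lt_or_gt_of_ne hj with h | h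
    · have := e3 j (by lia)
      rw [β, cut_eq_zero (e := -1) (by linarith), mul_zero, zero_mul]
    · have := e4 j (by lia)
      rw [β, cut_eq_zero (e := 1) (by linarith), zero_mul, zero_mul]
  have hα : ∀ j, j ≠ n → j ≠ n + 1 → S.α j t = 0 := by
    intro j hj hj'
    rcases lt_or_gt_of_ne hj with h | h
    · have := e3 (j + 1) (by lia)
      rw [α, cut_eq_zero (e := -1) (by linarith), mul_zero, zero_mul]
    · have := e4 j (by lia)
      rw [α, cut_eq_zero (e := 1) (by linarith), zero_mul, zero_mul]
  have h0 : ∀ j ∉ ({n, n + 1} : Finset ℕ), S.uTerm j (t, x) = 0 := by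
    intro j hj
    simp only [Finset.mem_insert, Finset.mem_singleton, not_or] at hj
    rw [uTerm]
    simp only
    rw [hα j hj.1 hj.2, hβ j hj.2]
    ring
  rw [u, tsum_eq_sum h0, Finset.sum_pair (by lia), uTerm, uTerm]
  simp only
  -- The two surviving `α` terms each have one cutoff already equal to 1: mode `n + 1` is fully on,
  -- mode `n + 2` not yet being removed.
  have c1 : S.cut 1 (-4) n t = 1 := cut_eq_one (by linarith)
  have c2 : S.cut (-1) 4 (n + 1 + 1) t = 1 := cut_eq_one (by linarith)
  rw [hβ n (by lia), α, α, c1, c2]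
  ring

theorem a_one : S.a 1 = 0 := by
  simp [a, hS.r_zero]

theorem tendsto_a : Filter.Tendsto S.a Filter.atTop (nhds 1) := by
  rw [← Filter.tendsto_add_atTop_iff_nat 1]
  have h := (hS.hasSum_r.tendsto_sum_nat.const_mul 8)
  have e : (fun n => S.a (n + 1)) = fun n => 8 * ∑ j ∈ Finset.range n, S.r (j + 1) := by
    ext n
    rw [a, Finset.sum_range_succ', hS.r_zero]
    ring
  rw [e]
  convert h using 2
  norm_num

theorem a_le_one (n : ℕ) : S.a n ≤ 1 := hS.a_mono.ge_of_tendsto hS.tendsto_a n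

theorem exists_step {t : ℝ} (h0 : 0 ≤ t) (h1 : t < 1) :
    ∃ n, S.a (n + 1) ≤ t ∧ t < S.a (n + 2) := by
  classical
  have hex : ∃ n, t < S.a n := ((hS.tendsto_a.eventually (lt_mem_nhds h1))).exists
  have hspec := Nat.find_spec hex
  have hmin := fun {j} => Nat.find_min hex (m := j)
  have h2 : 2 ≤ Nat.find hex := by
    by_contra! hlt
    have := hS.a_mono (show Nat.find hex ≤ 1 by lia)
    rw [hS.a_one] at this
    linarith
  obtain ⟨n, hn⟩ : ∃ n, Nat.find hex = n + 2 := ⟨Nat.find hex - 2, by lia⟩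
  rw [hn] at hspec
  exact ⟨n, not_lt.1 (hmin (by lia)), hspec⟩

theorem u_eq_zero {t : ℝ} (ht : 1 ≤ t) (x : ℝ × ℝ) : S.u (t, x) = 0 := by
  have h : ∀ j, 8 ≤ S.s j t := fun j =>
    hS.eight_le_s (Nat.lt_succ_self j) ((hS.a_le_one _).trans ht)
  have h0 : ∀ j, S.uTerm j (t, x) = 0 := fun j => by
    have h1 := h j
    have h2 := h (j + 1)
    rw [uTerm]
    simp only
    rw [α, β, cut_eq_zero (e := -1) (b := 4) (by linarith),
      cut_eq_zero (e := -1) (b := 7) (by linarith)]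
    ring
  simp [u, h0]

/-- Time 0 is the start of step 1, where only the `x₁` mode of index 1 is present. Step 0 lies in
negative time and serves to switch that mode on. -/
theorem u_initial_ne_zero : S.u (0, 0, 0) ≠ 0 := by
  have hr := hS.r_pos
  have h := hS.u_eq_near (n := 0) (t := 0) (by simpa [hS.a_one] using hr 0) (by
    have := hS.a_mono (show 1 ≤ 0 + 2 by lia)
    rw [hS.a_one] at this
    linarith [hr (0 + 2)]) (0, 0)
  have hs : S.s (0 + 1) 0 = 0 := by simp [s, hS.a_one]
  rw [h, cut_eq_one (by rw [hs]; norm_num), β, cut_eq_zero (e := 1) (by rw [hs]; norm_num),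
    cut_eq_zero (e := 1) (by rw [hs]; norm_num)]
  simp [cosX, v, Real.exp_ne_zero]

end Admissible

end Cascade

/-! ### Bounds and modulus of continuity of the leading coefficient -/

/-- The derivative of the modulation profile. -/
noncomputable def modulationRate (s : ℝ) : ℝ :=
  9 * (deriv Real.smoothTransition (s - 2) - deriv Real.smoothTransition (s - 5))

theorem exists_modulationRate_bound : ∃ M : ℝ, 0 < M ∧ (∀ s, |modulationRate s| ≤ M) ∧
    ∀ s s', |modulationRate s - modulationRate s'| ≤ M * |s - s'| := by
  obtain ⟨B₁, h₁⟩ := Real.smoothTransition.bounded_iteratedDeriv 1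
  obtain ⟨B₂, h₂⟩ := Real.smoothTransition.bounded_iteratedDeriv 2
  simp only [iteratedDeriv_succ, iteratedDeriv_zero] at h₁ h₂
  have hs : ContDiff ℝ ∞ (deriv Real.smoothTransition) :=
    ((contDiff_infty_iff_deriv).1 (Real.smoothTransition.contDiff (n := ⊤))).2
  have hlip : ∀ x y, |deriv Real.smoothTransition x - deriv Real.smoothTransition y| ≤
      B₂ * |x - y| := fun x y =>
    convex_univ.norm_image_sub_le_of_norm_deriv_le
      (fun z _ => hs.differentiable (by simp) z) (fun z _ => h₂ z) (mem_univ y) (mem_univ x)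
  have hB₁ : 0 ≤ B₁ := (abs_nonneg _).trans (h₁ 0)
  have hB₂ : 0 ≤ B₂ := (abs_nonneg _).trans (h₂ 0)
  refine ⟨18 * (B₁ + B₂) + 1, by positivity, fun s => ?_, fun s s' => ?_⟩
  · have e1 := h₁ (s - 2)
    have e2 := h₁ (s - 5)
    rw [modulationRate, abs_le]
    rw [abs_le] at e1 e2
    constructor <;> linarith
  · have e1 := hlip (s - 2) (s' - 2)
    have e2 := hlip (s - 5) (s' - 5)
    rw [sub_sub_sub_cancel_right] at e1 e2
    calc |modulationRate s - modulationRate s'| ≤ 18 * (B₂ * |s - s'|) := by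
          rw [modulationRate, modulationRate, abs_le]
          rw [abs_le] at e1 e2
          constructor <;> linarith
      _ ≤ (18 * (B₁ + B₂) + 1) * |s - s'| := by
          nlinarith [abs_nonneg (s - s'), mul_nonneg hB₁ (abs_nonneg (s - s'))]

namespace Cascade

variable {S : Cascade}

variable (S) in
/-- The deviation of the coefficient `l` from `1` in the `n`-th step. -/
noncomputable def lTerm (n : ℕ) (t : ℝ) : ℝ := S.p n / S.z n * deriv (S.J n) t

variable (S) in
/-- The coefficient of the leading derivative in `x₂`. -/
noncomputable def l (t : ℝ) : ℝ := 1 - ∑' n, S.lTerm n t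

theorem hasDerivAt_J (n : ℕ) (t : ℝ) :
    HasDerivAt (S.J n) (9 * deriv (S.cut 1 (-2) n) t - 9 * deriv (S.cut 1 (-5) n) t) t :=
  (((hasDerivAt_cut 1 (-2) n t).differentiableAt.hasDerivAt.const_mul 9).const_add (-8)).sub
    ((hasDerivAt_cut 1 (-5) n t).differentiableAt.hasDerivAt.const_mul 9)

namespace Admissible

variable (hS : S.Admissible)
include hS

theorem lTerm_eq (n : ℕ) (t : ℝ) :
    S.lTerm n t = S.d n / S.z n * modulationRate (S.s n t) := by
  have hr := (hS.r_pos n).ne'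
  have hz := (hS.z_pos n).ne'
  rw [lTerm, (hasDerivAt_J n t).deriv, (hasDerivAt_cut 1 (-2) n t).deriv,
    (hasDerivAt_cut 1 (-5) n t).deriv, ← d_mul_r, modulationRate]
  simp only [one_mul, ← sub_eq_add_neg]
  field_simp

omit hS in
theorem lTerm_eq_zero {n : ℕ} {t : ℝ} (h : S.s n t ≤ 0 ∨ 8 ≤ S.s n t) : S.lTerm n t = 0 := by
  rw [lTerm, (hasDerivAt_J n t).deriv]
  rcases h with h | h
  · rw [deriv_cut_eq_zero (Or.inl (by linarith)), deriv_cut_eq_zero (Or.inl (by linarith))]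
    ring
  · rw [deriv_cut_eq_zero (Or.inr (by linarith)), deriv_cut_eq_zero (Or.inr (by linarith))]
    ring

theorem exists_lTerm_eq_zero {t : ℝ} (ht : t ∈ Icc (0 : ℝ) 1) :
    ∃ n, ∀ j, j ≠ n → S.lTerm j t = 0 := by
  rcases ht.2.eq_or_lt with rfl | h1
  · exact ⟨0, fun j _ => lTerm_eq_zero
      (Or.inr (hS.eight_le_s (Nat.lt_succ_self j) (hS.a_le_one _)))⟩
  · obtain ⟨n, h2, h3⟩ := hS.exists_step ht.1 h1
    exact ⟨n + 1, fun j hj => lTerm_eq_zero (hS.s_nonpos_or_eight_le hj h2 h3.le)⟩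

theorem l_eq {n : ℕ} {t : ℝ} (h1 : S.a n ≤ t) (h2 : t ≤ S.a (n + 1)) :
    S.l t = 1 - S.lTerm n t := by
  rw [l, tsum_eq_single n fun j hj => lTerm_eq_zero (hS.s_nonpos_or_eight_le hj h1 h2)]

theorem l_mem {M : ℝ} (hM : ∀ s, |modulationRate s| ≤ M)
    (hd : ∀ n, S.d n / S.z n * M ≤ 1 / 2) {t : ℝ} (ht : t ∈ Icc (0 : ℝ) 1) :
    1 / 2 ≤ S.l t ∧ S.l t ≤ 3 / 2 := by
  obtain ⟨n, hn⟩ := hS.exists_lTerm_eq_zero ht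
  have h0 : 0 ≤ S.d n / S.z n := div_nonneg (hS.d_nonneg n) (hS.z_pos n).le
  have h : |S.lTerm n t| ≤ 1 / 2 := by
    rw [hS.lTerm_eq, abs_mul, abs_of_nonneg h0]
    exact (mul_le_mul_of_nonneg_left (hM _) h0).trans (hd n)
  rw [l, tsum_eq_single n hn]
  rw [abs_le] at h
  constructor <;> linarith

/-- Below the scale `r n` the profile is Lipschitz with constant of order `1 / r n`, and concavity
gives `(h / r n) * μ (r n) ≤ μ h`. Above that scale the sup bound and monotonicity of `μ` suffice.
-/
theorem abs_lTerm_sub_le {μ : ℝ → ℝ} (hconc : ConcaveOn ℝ (Icc 0 1) μ)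
    (hmono : StrictMonoOn μ (Icc 0 1)) (hzero : μ 0 = 0) {M C : ℝ} (hM0 : 0 < M) (hC : 0 ≤ C)
    (hM : ∀ s, |modulationRate s| ≤ M)
    (hM' : ∀ s s', |modulationRate s - modulationRate s'| ≤ M * |s - s'|)
    (hμ : ∀ n, S.d n / S.z n ≤ C * μ (S.r n)) (n : ℕ) {t t' : ℝ} (h1 : |t - t'| ≤ 1) :
    |S.lTerm n t - S.lTerm n t'| ≤ 2 * M * C * μ |t - t'| := by
  have hr := hS.r_pos n
  have hr1 : S.r n ∈ Icc (0 : ℝ) 1 := ⟨hr.le, hS.r_le_one n⟩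
  have ht1 : |t - t'| ∈ Icc (0 : ℝ) 1 := ⟨abs_nonneg _, h1⟩
  have h00 : (0 : ℝ) ∈ Icc (0 : ℝ) 1 := left_mem_Icc.2 zero_le_one
  have hμ0 : 0 ≤ μ |t - t'| := by
    rw [← hzero]
    exact hmono.monotoneOn h00 ht1 ht1.1
  have h0 : 0 ≤ S.d n / S.z n := div_nonneg (hS.d_nonneg n) (hS.z_pos n).le
  rw [hS.lTerm_eq, hS.lTerm_eq, ← mul_sub, abs_mul, abs_of_nonneg h0]
  rcases le_total |t - t'| (S.r n) with h | h
  · have hs : |S.s n t - S.s n t'| = |t - t'| / S.r n := by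
      rw [s, s, ← sub_div, abs_div, abs_of_pos hr, sub_sub_sub_cancel_right]
    have hle : |t - t'| / S.r n * μ (S.r n) ≤ μ |t - t'| := by
      have := hconc.le_mul_of_zero hzero (θ := |t - t'| / S.r n)
        ⟨by positivity, (div_le_one hr).2 h⟩ hr1
      rwa [div_mul_cancel₀ _ hr.ne'] at this
    calc _ ≤ (C * μ (S.r n)) * (M * (|t - t'| / S.r n)) := by
          rw [← hs]
          exact mul_le_mul (hμ n) (hM' _ _) (abs_nonneg _) (h0.trans (hμ n))
      _ = M * C * (|t - t'| / S.r n * μ (S.r n)) := by ring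
      _ ≤ M * C * μ |t - t'| := by gcongr
      _ ≤ 2 * M * C * μ |t - t'| := by
          have : 0 ≤ M * C * μ |t - t'| := by positivity
          linarith
  · have hle : μ (S.r n) ≤ μ |t - t'| := hmono.monotoneOn hr1 ht1 h
    have hsub : |modulationRate (S.s n t) - modulationRate (S.s n t')| ≤ 2 * M := by
      have e1 := hM (S.s n t)
      have e2 := hM (S.s n t')
      rw [abs_le] at e1 e2 ⊢
      constructor <;> linarith
    calc _ ≤ (C * μ (S.r n)) * (2 * M) :=
          mul_le_mul (hμ n) hsub (abs_nonneg _) (h0.trans (hμ n))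
      _ ≤ (C * μ |t - t'|) * (2 * M) := by gcongr
      _ = _ := by ring

theorem isModulusContinuousOn_l {μ : ℝ → ℝ} (hconc : ConcaveOn ℝ (Icc 0 1) μ)
    (hmono : StrictMonoOn μ (Icc 0 1)) (hzero : μ 0 = 0) {M C : ℝ} (hM0 : 0 < M) (hC : 0 ≤ C)
    (hM : ∀ s, |modulationRate s| ≤ M)
    (hM' : ∀ s s', |modulationRate s - modulationRate s'| ≤ M * |s - s'|)
    (hμ : ∀ n, S.d n / S.z n ≤ C * μ (S.r n)) : IsModulusContinuousOn μ (Icc 0 1) S.l := by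
  refine ⟨4 * M * C, fun t ht t' ht' hpos hle => ?_⟩
  have hμ0 : 0 < μ |t - t'| := by
    rw [← hzero]
    exact hmono (left_mem_Icc.2 zero_le_one) ⟨hpos.le, hle⟩ hpos
  have key := fun n => hS.abs_lTerm_sub_le hconc hmono hzero hM0 hC hM hM' hμ n hle
  rw [div_le_iff₀ hμ0, Real.norm_eq_abs]
  obtain ⟨i, hi⟩ := hS.exists_lTerm_eq_zero ht
  obtain ⟨j, hj⟩ := hS.exists_lTerm_eq_zero ht'
  rw [l, l, tsum_eq_single i hi, tsum_eq_single j hj]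
  have e1 := key i
  have e2 := key j
  rw [abs_le] at e1 e2 ⊢
  have h0 : 0 ≤ 2 * M * C * μ |t - t'| := by positivity
  -- For times in different steps, each active term vanishes at the other time, so two single-term
  -- estimates add up; hence the factor 4.
  by_cases hij : i = j
  · subst hij
    constructor <;> linarith
  · rw [hj i hij] at e1
    rw [hi j (Ne.symm hij)] at e2
    constructor <;> linarith

/-! ### The differential equation -/

omit hS in
theorem hasDerivAt_v (n : ℕ) (t : ℝ) : HasDerivAt (S.v n) (-S.z n * S.v n t) t := by
  have h : HasDerivAt (fun t => -S.q n - S.z n * (t - S.a n)) (-S.z n) t := by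
    simpa using (((hasDerivAt_id t).sub_const (S.a n)).const_mul (S.z n)).const_sub (-S.q n)
  have h2 := h.exp
  rw [mul_comm] at h2
  exact h2

theorem hasDerivAt_β (n : ℕ) (t : ℝ) : HasDerivAt (S.β n)
    ((deriv (S.cut 1 (-1) n) t * S.cut (-1) 7 n t + S.cut 1 (-1) n t * deriv (S.cut (-1) 7 n) t) *
      Real.exp (S.phase n t) + S.β n t * (-S.z n + S.p n * deriv (S.J n) t)) t := by
  have h := ((hasDerivAt_cut (S := S) 1 (-1) n t).differentiableAt.hasDerivAt.mul
    (hasDerivAt_cut (S := S) (-1) 7 n t).differentiableAt.hasDerivAt).mul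
    (hS.hasDerivAt_phase n t).exp
  refine h.congr_deriv ?_
  simp only [β, Pi.mul_apply]
  ring

/-- `u` is smooth on the whole space and vanishes for `t ≥ 1`, so the left derivative equals the
right one, which is zero. -/
theorem partialT_u_one (x₁ x₂ : ℝ) : partialT S.u 1 x₁ x₂ = 0 := by
  have hu : DifferentiableAt ℝ (fun t => S.u (t, x₁, x₂)) 1 := by
    have : ContDiff ℝ ∞ (fun t : ℝ => S.u (t, x₁, x₂)) :=
      hS.contDiff_u.comp (contDiff_id.prodMk contDiff_const)
    exact this.differentiable (by simp) 1
  have h1 : derivWithin (fun t => S.u (t, x₁, x₂)) (Ici 1) 1 = 0 := by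
    have h : EqOn (fun t => S.u (t, x₁, x₂)) (fun _ => (0 : ℝ)) (Ici (1 : ℝ)) :=
      fun t ht => hS.u_eq_zero ht (x₁, x₂)
    rw [derivWithin_congr h (h self_mem_Ici)]
    simp
  rw [partialT, hu.derivWithin (uniqueDiffOn_Icc one_pos 1 (right_mem_Icc.2 zero_le_one)),
    ← hu.derivWithin (uniqueDiffOn_Ici 1 1 self_mem_Ici), h1]

theorem equation {t : ℝ} (ht : t ∈ Icc (0 : ℝ) 1) (x₁ x₂ : ℝ) :
    partialT S.u t x₁ x₂
      + (-1) ^ S.m * (partialX₁ (2 * S.m) S.u t x₁ x₂ + S.l t * partialX₂ (2 * S.m) S.u t x₁ x₂)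
      + S.b₁ (t, x₁, x₂) * partialX₁ 1 S.u t x₁ x₂
      + S.b₂ (t, x₁, x₂) * partialX₂ 1 S.u t x₁ x₂
      + S.c (t, x₁, x₂) * S.u (t, x₁, x₂) = 0 := by
  rcases ht.2.eq_or_lt with rfl | ht1
  · have hX : ∀ k, partialX₁ k S.u 1 x₁ x₂ = 0 := fun k => by
      simp only [partialX₁, hS.u_eq_zero le_rfl]
      simp
    have hY : ∀ k, partialX₂ k S.u 1 x₁ x₂ = 0 := fun k => by
      simp only [partialX₂, hS.u_eq_zero le_rfl]
      simp
    rw [hS.partialT_u_one, hX, hX, hY, hY, hS.u_eq_zero le_rfl]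
    ring
  obtain ⟨n, hn1, hn2⟩ := hS.exists_step ht.1 ht1
  -- The three-mode formula holds slightly beyond both ends of the step, so it can be differentiated
  -- at the endpoints without gluing.
  have hlo : S.a (n + 1) - S.r n < t := by linarith [hS.r_pos n]
  have hhi : t < S.a (n + 2) + S.r (n + 2) := by linarith [hS.r_pos (n + 2)]
  have hu := fun x => hS.u_eq_near hlo hhi x
  have hT : partialT S.u t x₁ x₂ =
      (deriv (S.cut (-1) 4 (n + 1)) t * S.v (n + 1) t +
        S.cut (-1) 4 (n + 1) t * (-S.z (n + 1) * S.v (n + 1) t)) * Real.cos (S.k (n + 1) * x₁) +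
      ((deriv (S.cut 1 (-1) (n + 1)) t * S.cut (-1) 7 (n + 1) t +
        S.cut 1 (-1) (n + 1) t * deriv (S.cut (-1) 7 (n + 1)) t) * Real.exp (S.phase (n + 1) t) +
        S.β (n + 1) t * (-S.z (n + 1) + S.p (n + 1) * deriv (S.J (n + 1)) t)) *
        Real.cos (S.k (n + 1) * x₂) +
      (deriv (S.cut 1 (-4) (n + 1)) t * S.v (n + 2) t +
        S.cut 1 (-4) (n + 1) t * (-S.z (n + 2) * S.v (n + 2) t)) *
        Real.cos (S.k (n + 2) * x₁) := by
    have h3 := (hasDerivAt_cut (S := S) (-1) 4 (n + 1) t).differentiableAt.hasDerivAt.mul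
      (hasDerivAt_v (S := S) (n + 1) t)
    have h4 := (hasDerivAt_cut (S := S) 1 (-4) (n + 1) t).differentiableAt.hasDerivAt.mul
      (hasDerivAt_v (S := S) (n + 2) t)
    have h := ((h3.mul_const (Real.cos (S.k (n + 1) * x₁))).add
      ((hS.hasDerivAt_β (n + 1) t).mul_const (Real.cos (S.k (n + 1) * x₂)))).add
      (h4.mul_const (Real.cos (S.k (n + 2) * x₁)))
    have hev : (fun τ => S.u (τ, x₁, x₂)) =ᶠ[nhds t] _ :=
      (Filter.eventually_of_mem (Ioo_mem_nhds hlo hhi) fun τ hτ =>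
        hS.u_eq_near hτ.1 hτ.2 (x₁, x₂))
    exact (h.congr_of_eventuallyEq hev).hasDerivWithinAt.derivWithin
      (uniqueDiffOn_Icc one_pos t ht)
  have hX : (-1) ^ S.m * partialX₁ (2 * S.m) S.u t x₁ x₂ =
      S.z (n + 1) * (S.cut (-1) 4 (n + 1) t * S.v (n + 1) t * Real.cos (S.k (n + 1) * x₁)) +
      S.z (n + 2) * (S.cut 1 (-4) (n + 1) t * S.v (n + 2) t * Real.cos (S.k (n + 2) * x₁)) := by
    simp only [partialX₁, hu, cosX, cosY]
    exact neg_one_pow_mul_iteratedDeriv_cos_add hS.one_le_m _ _ _ _ _ _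
  have hY : (-1) ^ S.m * partialX₂ (2 * S.m) S.u t x₁ x₂ =
      S.z (n + 1) * (S.β (n + 1) t * Real.cos (S.k (n + 1) * x₂)) := by
    have e : (fun y => S.u (t, x₁, y)) = fun y => S.β (n + 1) t * Real.cos (S.k (n + 1) * y) +
        (S.cut (-1) 4 (n + 1) t * S.v (n + 1) t * Real.cos (S.k (n + 1) * x₁) +
          S.cut 1 (-4) (n + 1) t * S.v (n + 2) t * Real.cos (S.k (n + 2) * x₁)) +
        0 * Real.cos (0 * y) := by
      ext y
      rw [hu]
      simp only [cosX, cosY]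
      ring
    rw [partialX₂, e, neg_one_pow_mul_iteratedDeriv_cos_add hS.one_le_m, z]
    ring
  have hlin : ∀ k y : ℝ, HasDerivAt (fun y => k * y) k y := fun k y => by
    simpa using (hasDerivAt_id y).const_mul k
  have hX1 : partialX₁ 1 S.u t x₁ x₂ =
      -(S.k (n + 1) * (S.cut (-1) 4 (n + 1) t * S.v (n + 1) t) * Real.sin (S.k (n + 1) * x₁)) -
      S.k (n + 2) * (S.cut 1 (-4) (n + 1) t * S.v (n + 2) t) * Real.sin (S.k (n + 2) * x₁) := by
    simp only [partialX₁, hu, cosX, cosY, iteratedDeriv_one]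
    refine ((((hlin _ x₁).cos.const_mul _).add_const _).add
      ((hlin _ x₁).cos.const_mul _)).deriv.trans ?_
    ring
  have hY1 : partialX₂ 1 S.u t x₁ x₂ =
      -(S.k (n + 1) * S.β (n + 1) t * Real.sin (S.k (n + 1) * x₂)) := by
    simp only [partialX₂, hu, cosX, cosY, iteratedDeriv_one]
    refine ((((hlin _ x₂).cos.const_mul _).const_add _).add_const _).deriv.trans ?_
    ring
  -- `l` is defined so that the `x₂` decay rate is exactly minus the derivative of `phase`; only
  -- derivatives of cutoffs then remain.
  have hl : S.z (n + 1) * S.l t = S.z (n + 1) - S.p (n + 1) * deriv (S.J (n + 1)) t := by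
    have := (hS.z_pos (n + 1)).ne'
    rw [hS.l_eq hn1 hn2.le, lTerm]
    field_simp
  have hid := hS.lower_order_identity (n + 1) t (x₁, x₂)
  rw [hS.b₁_eq hn1 hn2.le, hS.b₂_eq hn1 hn2.le, hS.c_eq hn1 hn2.le, mul_add,
    mul_left_comm _ (S.l t), hX, hY, hT, hX1, hY1, hu]
  simp only [cosX, cosY, sinX, sinY] at hid ⊢
  linear_combination hid + S.β (n + 1) t * Real.cos (S.k (n + 1) * x₂) * hl

end Admissible

end Cascade

/-! ### Quadratic frequencies and their growth conditions -/

theorem one_add_pow_le {y : ℝ} (h0 : 0 ≤ y) (h1 : y ≤ 1) (M : ℕ) :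
    (1 + y) ^ M ≤ 1 + (2 ^ M - 1) * y := by
  induction M with
  | zero => simp
  | succ M ih =>
    have h2 : (1 : ℝ) ≤ 2 ^ M := one_le_pow₀ (by norm_num)
    have h3 : 0 ≤ (2 ^ M - 1) * y * (1 - y) := by
      have := sub_nonneg.2 h1
      have := sub_nonneg.2 h2
      positivity
    calc (1 + y) ^ (M + 1) = (1 + y) ^ M * (1 + y) := pow_succ _ _
      _ ≤ (1 + (2 ^ M - 1) * y) * (1 + y) := by gcongr
      _ ≤ 1 + (2 ^ (M + 1) - 1) * y := by
        rw [pow_succ]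
        linarith

theorem summable_pow_mul_exp_of_le {c : ℝ} (hc : 0 < c) {p : ℕ → ℝ}
    (hp : ∀ n : ℕ, c * n ≤ p n) (D : ℕ) :
    Summable fun n : ℕ => ((n : ℝ) + 1) ^ D * Real.exp (-p n) := by
  have h := ((summable_nat_add_iff 1).2 (Real.summable_pow_mul_exp_neg_nat_mul D hc)).mul_left
    (Real.exp c)
  refine Summable.of_nonneg_of_le (fun n => by positivity) (fun n => ?_) h
  calc ((n : ℝ) + 1) ^ D * Real.exp (-p n)
      ≤ ((n : ℝ) + 1) ^ D * Real.exp (c + -c * ((n : ℝ) + 1)) := by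
        gcongr
        linarith [hp n]
    _ = Real.exp c * (((n + 1 : ℕ) : ℝ) ^ D * Real.exp (-c * ((n + 1 : ℕ) : ℝ))) := by
        rw [Real.exp_add]
        push_cast
        ring

/-- The cascade with frequencies `(n + N) ^ 2`. -/
noncomputable def quadraticCascade (m : ℕ) (r : ℕ → ℝ) (N : ℕ) : Cascade :=
  ⟨m, r, fun n => ((n : ℝ) + N) ^ 2⟩

section QuadraticCascade

variable {m : ℕ} {r : ℕ → ℝ} {N : ℕ}

theorem quadraticCascade_z (n : ℕ) :
    (quadraticCascade m r N).z n = ((n : ℝ) + N) ^ (4 * m) := by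
  simp only [Cascade.z, quadraticCascade, ← pow_mul]
  congr 1
  ring

theorem quadraticCascade_d (n : ℕ) : (quadraticCascade m r N).d n =
    ((n : ℝ) + N + 1) ^ (4 * m) - ((n : ℝ) + N) ^ (4 * m) := by
  rw [Cascade.d, quadraticCascade_z, quadraticCascade_z]
  push_cast
  ring

theorem quadraticCascade_d_div_z_le (hN : 1 ≤ N) (n : ℕ) :
    (quadraticCascade m r N).d n / (quadraticCascade m r N).z n ≤
      2 ^ (4 * m) / ((n : ℝ) + N) := by
  have hN' : (1 : ℝ) ≤ N := by exact_mod_cast hN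
  have hx : 1 ≤ (n : ℝ) + N := by linarith [(Nat.cast_nonneg n : (0 : ℝ) ≤ n)]
  rw [quadraticCascade_d, quadraticCascade_z]
  set x := (n : ℝ) + N
  have hx0 : 0 < x := by linarith
  have h := one_add_pow_le (y := 1 / x) (by positivity) ((div_le_one hx0).2 hx) (4 * m)
  have e : (1 + 1 / x) ^ (4 * m) = (x + 1) ^ (4 * m) / x ^ (4 * m) := by
    rw [← div_pow]
    congr 1
    field_simp
  rw [sub_div, div_self (by positivity), ← e]
  have h2 : 0 ≤ 1 / x := by positivity
  calc _ ≤ (2 ^ (4 * m) - 1) * (1 / x) := by linarith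
    _ ≤ 2 ^ (4 * m) * (1 / x) := by gcongr; linarith
    _ = _ := by ring

/-- Since `4 * m ≥ 4`, both `d n` and `z n` are at least `(n + N) ^ 3`. Against `r n ≥ c / (n+1)^2`
this leaves linear growth for `p` and `q`. The square in the frequency is what makes the cubic bound
on `d` available even for `m = 1`. -/
theorem quadraticCascade_admissible {c : ℝ} (hm : 1 ≤ m) (hN : 1 ≤ N) (hc : 0 < c)
    (hr0 : r 0 = 1) (hsum : HasSum (fun n => r (n + 1)) (1 / 8))
    (hr : ∀ n : ℕ, c / ((n : ℝ) + 1) ^ 2 ≤ r n) (hcN : 1 ≤ c * N) (hmN : 2 ^ (4 * m) ≤ 2 * N) :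
    (quadraticCascade m r N).Admissible := by
  have hN' : (1 : ℝ) ≤ N := by exact_mod_cast hN
  have hx : ∀ n : ℕ, 1 ≤ (n : ℝ) + N := fun n => by
    linarith [(Nat.cast_nonneg n : (0 : ℝ) ≤ n)]
  have hx' : ∀ n : ℕ, (n : ℝ) + 1 ≤ (n : ℝ) + N := fun n => by linarith
  have hrpos : ∀ n, 0 < r n := fun n => lt_of_lt_of_le (by positivity) (hr n)
  have hz : ∀ n, 0 < (quadraticCascade m r N).z n := fun n => by
    rw [quadraticCascade_z]
    have := hx n
    positivity
  have hpow : ∀ x y : ℝ, 0 < y → y ≤ x → c * x ≤ x ^ 3 * (c / y ^ 2) := fun x y hy hxy => by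
    rw [mul_div_assoc', le_div_iff₀ (by positivity)]
    have : 0 < x := by linarith
    calc c * x * y ^ 2 ≤ c * x * x ^ 2 := by gcongr
      _ = _ := by ring
  have hp : ∀ n : ℕ, c * ((n : ℝ) + N) ≤ (quadraticCascade m r N).p n := by
    intro n
    have h1 := hx n
    have hd : ((n : ℝ) + N) ^ 3 ≤ (quadraticCascade m r N).d n := by
      obtain ⟨j, hj⟩ : ∃ j, 4 * m = j + 1 := ⟨4 * m - 1, by lia⟩
      have h2 : ((n : ℝ) + N) ^ j ≤ ((n : ℝ) + N + 1) ^ j :=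
        pow_le_pow_left₀ (by linarith) (by linarith) j
      have h3 : ((n : ℝ) + N) ^ 3 ≤ ((n : ℝ) + N) ^ j := pow_le_pow_right₀ h1 (by lia)
      have h4 : ((n : ℝ) + N) ^ j * ((n : ℝ) + N + 1) ≤
          ((n : ℝ) + N + 1) ^ j * ((n : ℝ) + N + 1) := by gcongr
      rw [quadraticCascade_d, hj, pow_succ _ j, pow_succ _ j]
      linarith
    calc c * ((n : ℝ) + N) ≤ ((n : ℝ) + N) ^ 3 * (c / ((n : ℝ) + 1) ^ 2) :=
          hpow _ _ (by positivity) (hx' n)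
      _ ≤ (quadraticCascade m r N).d n * r n :=
          mul_le_mul hd (hr n) (by positivity) (le_trans (by positivity) hd)
  have hq0 : ∀ n, 0 ≤ (quadraticCascade m r N).q n := by
    intro n
    induction n with
    | zero => exact le_rfl
    | succ n ih =>
      have h1 := hz (n + 1)
      have h2 : 0 < (quadraticCascade m r N).r n := hrpos n
      rw [Cascade.q]
      positivity
  have hq : ∀ n : ℕ, c * n ≤ (quadraticCascade m r N).q n := by
    rintro (_ | n)
    · simp [Cascade.q]
    · have h1 := hx (n + 1)
      have h2 : ((n + 1 : ℕ) + (N : ℝ)) ^ 3 ≤ (quadraticCascade m r N).z (n + 1) := by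
        rw [quadraticCascade_z]
        exact pow_le_pow_right₀ h1 (by lia)
      have h3 : c * ((n + 1 : ℕ) + (N : ℝ)) ≤
          ((n + 1 : ℕ) + (N : ℝ)) ^ 3 * (c / ((n : ℝ) + 1) ^ 2) :=
        hpow _ _ (by positivity) (by push_cast; linarith)
      have h4 : ((n + 1 : ℕ) + (N : ℝ)) ^ 3 * (c / ((n : ℝ) + 1) ^ 2) ≤
          (quadraticCascade m r N).z (n + 1) * r n :=
        mul_le_mul h2 (hr n) (by positivity) (hz _).le
      have h5 : c * ((n + 1 : ℕ) : ℝ) ≤ c * ((n + 1 : ℕ) + (N : ℝ)) := by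
        gcongr
        linarith
      have h6 := hq0 n
      have h7 : 0 ≤ (quadraticCascade m r N).z (n + 1) * r n := mul_nonneg (hz _).le (hrpos n).le
      rw [Cascade.q]
      change _ ≤ _ + 8 * _ * r n
      linarith
  refine ⟨hm, hrpos, hr0, hsum, ?_, fun n => ?_, fun i j hij => ?_, ?_, fun n => ?_, fun n => ?_,
    summable_pow_mul_exp_of_le hc fun n => ?_, summable_pow_mul_exp_of_le hc hq⟩
  · refine ⟨1 / c, 2, by positivity, fun n _ => ?_⟩
    have h2 : |(r n)⁻¹| ≤ (c / ((n : ℝ) + 1) ^ 2)⁻¹ := by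
      rw [abs_of_pos (inv_pos.2 (hrpos n))]
      exact inv_anti₀ (by positivity) (hr n)
    refine h2.trans (le_of_eq ?_)
    field_simp
  · exact one_le_pow₀ (hx n)
  · have h1 := hx i
    have h2 : (i : ℝ) ≤ j := by exact_mod_cast hij
    simp only [quadraticCascade]
    gcongr
  · refine ⟨(N : ℝ) ^ 2, 2, by positivity, fun n _ => ?_⟩
    have h1 := hx n
    simp only [quadraticCascade, mul_one]
    rw [abs_of_nonneg (by positivity), ← mul_pow]
    gcongr
    nlinarith [mul_nonneg (sub_nonneg.2 hN') (Nat.cast_nonneg n : (0 : ℝ) ≤ n)]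
  · have h1 := quadraticCascade_d_div_z_le (m := m) (r := r) hN n
    have h2 : (2 : ℝ) ^ (4 * m) / ((n : ℝ) + N) ≤ 2 := by
      have := hx n
      rw [div_le_iff₀ (by linarith)]
      have h3 : (2 : ℝ) ^ (4 * m) ≤ 2 * N := by exact_mod_cast hmN
      linarith [(Nat.cast_nonneg n : (0 : ℝ) ≤ n)]
    exact (div_le_iff₀ (hz n)).1 (h1.trans h2)
  · refine le_trans ?_ (hp n)
    have : 0 ≤ c * n := by positivity
    linarith
  · refine le_trans ?_ (hp n)
    gcongr
    linarith

end QuadraticCascade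

/-! ### Choice of parameters and conclusion -/

theorem theorem2 (μ : ℝ → ℝ) (hmaps : MapsTo μ (Icc 0 1) (Icc 0 1))
    (hconc : ConcaveOn ℝ (Icc 0 1) μ) (hmono : StrictMonoOn μ (Icc 0 1)) (hzero : μ 0 = 0)
    (hosgood : ¬ OsgoodCondition μ) (m : ℕ) (hm : 1 ≤ m) :
    ∃ (l : ℝ → ℝ) (b₁ b₂ c u : ℝ × ℝ × ℝ → ℝ),
      IsModulusContinuousOn μ (Icc 0 1) l ∧
      (∀ t ∈ Icc (0 : ℝ) 1, 1 / 2 ≤ l t ∧ l t ≤ 3 / 2) ∧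
      IsSmoothBounded b₁ ∧ IsSmoothBounded b₂ ∧ IsSmoothBounded c ∧ IsSmoothBounded u ∧
      (∀ x₁ x₂ : ℝ, u (1, x₁, x₂) = 0) ∧
      (∃ t ∈ Icc (0 : ℝ) 1, ∃ x₁ x₂ : ℝ, u (t, x₁, x₂) ≠ 0) ∧
      ∀ t ∈ Icc (0 : ℝ) 1, ∀ x₁ x₂ : ℝ,
        partialT u t x₁ x₂
          + (-1) ^ m * (partialX₁ (2 * m) u t x₁ x₂ + l t * partialX₂ (2 * m) u t x₁ x₂)
          + b₁ (t, x₁, x₂) * partialX₁ 1 u t x₁ x₂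
          + b₂ (t, x₁, x₂) * partialX₂ 1 u t x₁ x₂
          + c (t, x₁, x₂) * u (t, x₁, x₂) = 0 := by
  obtain ⟨r, c, hc, hr0, hsum, hr, -, hμr⟩ := exists_step_lengths hmaps hconc hmono hzero hosgood
  obtain ⟨M, hM0, hM, hM'⟩ := exists_modulationRate_bound
  -- The three bounds on the frequency offset ensure in turn `p n ≥ 1`, `d n ≤ 2 * z n`, and an
  -- oscillation of `l` of at most `1 / 2`.
  obtain ⟨N, hN⟩ := exists_nat_ge (max (1 / c) (max (2 ^ (4 * m)) (2 * 2 ^ (4 * m) * M)))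
  simp only [max_le_iff] at hN
  obtain ⟨hN1, hN2, hN3⟩ := hN
  have hN2' : 2 ^ (4 * m) ≤ N := by exact_mod_cast hN2
  have hN0 : 1 ≤ N := Nat.one_le_two_pow.trans hN2'
  have hN0' : (0 : ℝ) < N := by exact_mod_cast hN0
  have hcN : 1 ≤ c * N := by
    rw [div_le_iff₀ hc] at hN1
    linarith
  set S := quadraticCascade m r N
  have hS : S.Admissible :=
    quadraticCascade_admissible hm hN0 hc hr0 hsum hr hcN (by lia)
  have hdz := quadraticCascade_d_div_z_le (m := m) (r := r) hN0
  have hd : ∀ n, S.d n / S.z n * M ≤ 1 / 2 := by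
    intro n
    calc S.d n / S.z n * M ≤ 2 ^ (4 * m) / ((n : ℝ) + N) * M :=
          mul_le_mul_of_nonneg_right (hdz n) hM0.le
      _ ≤ 2 ^ (4 * m) / N * M := by
        gcongr
        linarith [(Nat.cast_nonneg n : (0 : ℝ) ≤ n)]
      _ ≤ 1 / 2 := by
        rw [div_mul_eq_mul_div, div_le_div_iff₀ hN0' two_pos]
        linarith
  have hμ : ∀ n, S.d n / S.z n ≤ 2 ^ (4 * m) / c * μ (S.r n) := by
    intro n
    have hN1' : (1 : ℝ) ≤ N := by exact_mod_cast hN0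
    calc S.d n / S.z n ≤ 2 ^ (4 * m) / ((n : ℝ) + N) := hdz n
      _ ≤ 2 ^ (4 * m) / ((n : ℝ) + 1) := by gcongr
      _ = 2 ^ (4 * m) / c * (c / ((n : ℝ) + 1)) := by field_simp
      _ ≤ 2 ^ (4 * m) / c * μ (S.r n) := by gcongr; exact hμr n
  exact ⟨S.l, S.b₁, S.b₂, S.c, S.u,
    hS.isModulusContinuousOn_l hconc hmono hzero hM0 (by positivity) hM hM' hμ,
    fun t ht => hS.l_mem hM hd ht, hS.isSmoothBounded_b₁, hS.isSmoothBounded_b₂,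
    hS.isSmoothBounded_c, hS.isSmoothBounded_u, fun x₁ x₂ => hS.u_eq_zero le_rfl (x₁, x₂),
    ⟨0, left_mem_Icc.2 zero_le_one, 0, 0, hS.u_initial_ne_zero⟩,
    fun t ht x₁ x₂ => hS.equation ht x₁ x₂⟩
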